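/- **Setting.** Let $P\subset\mathbb{R}^2$ be a closed simple polygon with a given triangulation whose triangles have vertices among the vertices of $P$ and meet only along common faces. For $x,y\in P$ let $d(x,y)$ be the length of a shortest path from $x$ to $y$ in the visibility graph with nodes $x$, $y$ and the vertices of $P$ (two nodes are adjacent if the segment joining them lies in $P$), and let $\beta_\delta(q)=\{x\in P: d(q,x)<\delta\}$. Let $\mathbb{G}$ be any set of guards, each guard $g$ moving on its own diagonal $h_g$ (an edge of the triangulation), of length $l_g$; let $r>0$ be the speed ratio of guards and intruder and $d_g=l_g/r$. A guard is *incident* to a triangle $T$ if an endpoint of its diagonal is a vertex of $T$. A triangle is *safe* if some guard's diagonal is one of its edges. **Procedure.** Guards are allocated one at a time. A set $D$ of deleted (triangle, guard) pairs is maintained, initially empty. Call a triangle $T$ *available* to $g$ at an endpoint $w$ of $h_g$ if $T$ is non-safe, $w$ is a vertex of $T$, and $(T,g)\notin D$. * An unallocated guard $g$ is *ready* at an endpoint $u$ of $h_g$ if, for every triangle $T$ available to $g$ at $u$ and every other guard $k$ incident to $T$ with $(T,k)\notin D$, the region $R^2_T(k)$ is already defined. (This holds in particular if every non-safe triangle at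 $u$ is incident to no guard but $g$.) * If some guard is ready, any guard $g$ ready at some endpoint $u$ is chosen and allocated, with $u$ as its first and the other endpoint $u'$ of $h_g$ as its second endpoint. For each $T$ available to $g$ at $u$, $$R^1_T(g)=T\setminus\bigcup_{k\neq g\text{ incident to }T}R^2_T(k),\qquad \hat U^1_R(g)=\bigcup_T R^1_T(g),$$ where regions not defined count as empty. For each $T$ available to $g$ at $u'$, $$R^2_T(g)=T^{free}\cap\bigcap_{q\in\hat U^1_R(g)}\beta_{d_g}(q)^c\ \text{ if }\hat U^1_R(g)\neq\emptyset,\qquad R^2_T(g)=T^{free}\ \text{ otherwise},$$ where $T^{free}$ is the set of points of $T$ not in any region $R^1_T(k)$ or $R^2_T(k)$ assigned so far. Put $\hat U^2_R(g)=\bigcup_T R^2_T(g)$. * If no guard is ready and some guard is unallocated, an arbitrary unallocated guard $g$ and an arbitrary endpoint $u$ of $h_g$ are chosen, and for every non-safe triangle $T$ with vertex $u$ and every other unallocated guard $k$ incident to $T$ the pair $(T,k)$ is added to $D$. (The choices are arbitrary. The test whether a triangle is completely covered, after which the algorithm may stop with failure, does not affect the regions already computed; the statement holds for runs with or without it.)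 **Lemma.** In every run of this procedure, for every guard $g$ that has been allocated, both regions $\hat U^1_R(g)$ and $\hat U^2_R(g)$ are bounded by finitely many circular arcs and line segments: the topological boundary in $\mathbb{R}^2$ of each of them is the union of a finite (possibly empty) family of closed circular arcs of positive radius and closed line segments, where a single point is admitted as a degenerate segment. -/

import Mathlib

noncomputable section

namespace GuardTracking

/-- The Euclidean plane. -/
abbrev Plane : Type := EuclideanSpace ℝ (Fin 2)

/-! ### Circular arcs and sets bounded by them -/

/-- A closed arc of the circle with centre `c` and radius `ρ`, swept from angle `a` to angle `b`. -/
def circularArc (c : Plane) (ρ a b : ℝ) : Set Plane :=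
  (fun θ : ℝ => c + ρ • !₂[Real.cos θ, Real.sin θ]) '' Set.Icc a b

/-- `A` is a circular arc of positive radius or a line segment.  The endpoints of a segment may
coincide, so that a single point (an isolated boundary point) counts as a segment. -/
def IsArcOrSegment (A : Set Plane) : Prop :=
  (∃ (c : Plane) (ρ a b : ℝ), 0 < ρ ∧ a ≤ b ∧ A = circularArc c ρ a b) ∨
    ∃ x y : Plane, A = segment ℝ x y

/-- The topological boundary of `U` in the plane is a finite union of arcs and segments. -/
def BoundedByArcs (U : Set Plane) : Prop :=
  ∃ 𝒜 : Set (Set Plane), 𝒜.Finite ∧ (∀ A ∈ 𝒜, IsArcOrSegment A) ∧ frontier U = ⋃₀ 𝒜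

/-! ### Simple polygons, the visibility-graph distance, triangulations -/

/-- A simple polygon: at least three vertices, distinct vertices, and two different edges meet at
most in a vertex that is an endpoint of both (consecutive indices are taken cyclically). -/
structure IsSimplePolygon {n : ℕ} (p : Polygon Plane n) : Prop where
  three_le : 3 ≤ n
  injective : Function.Injective p.vertices
  edges_inter : ∀ i j : Fin n, i ≠ j → p.edgeSet ℝ i ∩ p.edgeSet ℝ j ⊆
    {x | ∃ k : Fin n, (k = i ∨ k = finRotate n i) ∧ (k = j ∨ k = finRotate n j) ∧ x = p k}

/-- The closed region enclosed by a polygon: its boundary curve together with the points of the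
complement of the curve that lie in a bounded connected component of that complement. -/
def region {n : ℕ} (p : Polygon Plane n) : Set Plane :=
  p.boundary ℝ ∪ {x | x ∉ p.boundary ℝ ∧
    Bornology.IsBounded (connectedComponentIn (p.boundary ℝ)ᶜ x)}

/-- Length of the polygonal chain through a list of points. -/
def chainLength : List Plane → ENNReal
  | [] => 0
  | [_] => 0
  | a :: b :: l => edist a b + chainLength (b :: l)

/-- The chain of points from `x` to `y` whose intermediate nodes are the listed vertices. -/
def chainThrough {n : ℕ} (p : Polygon Plane n) (x y : Plane) (l : List (Fin n)) : List Plane :=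
  x :: (l.map p.vertices ++ [y])

/-- The distance in the polygon: the length of a shortest path from `x` to `y` in the visibility
graph whose nodes are `x`, `y` and the vertices of the polygon, two nodes being joined when the
segment between them lies in the polygon (`⊤` if there is no path). -/
def polyDist {n : ℕ} (p : Polygon Plane n) (x y : Plane) : ENNReal :=
  ⨅ (l : List (Fin n))
    (_ : (chainThrough p x y l).IsChain (fun a b => segment ℝ a b ⊆ region p)),
    chainLength (chainThrough p x y l)

/-- The open ball of radius `δ` around `q` for the distance of the polygon. -/
def polyBall {n : ℕ} (p : Polygon Plane n) (δ : ℝ) (q : Plane) : Set Plane :=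
  {x | x ∈ region p ∧ polyDist p q x < ENNReal.ofReal δ}

/-- The convex hull of the vertices with indices in `t`. -/
def hull {n : ℕ} (p : Polygon Plane n) (t : Finset (Fin n)) : Set Plane :=
  convexHull ℝ (p.vertices '' (t : Set (Fin n)))

/-- A triangulation of the polygon without additional vertices: nondegenerate triangles (given by
their vertex triples) that meet only along common faces and whose union is the polygon. -/
structure IsTriangulation {n : ℕ} (p : Polygon Plane n) (𝒯 : Finset (Finset (Fin n))) : Prop where
  card_eq : ∀ t ∈ 𝒯, t.card = 3
  affineIndependent : ∀ t ∈ 𝒯, AffineIndependent ℝ (fun i : t => p.vertices i)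
  inter_eq : ∀ t ∈ 𝒯, ∀ t' ∈ 𝒯, hull p t ∩ hull p t' = hull p (t ∩ t')
  iUnion_eq : ⋃ t ∈ 𝒯, hull p t = region p

/-- A triangulated simple polygon with a deployment of diagonal guards.  A guard is identified with
the diagonal (edge of the triangulation, given by its pair of endpoints) on which it moves. -/
structure GuardedPolygon (n : ℕ) where
  /-- the polygon -/
  poly : Polygon Plane n
  simple : IsSimplePolygon poly
  /-- the triangles of the triangulation -/
  triangles : Finset (Finset (Fin n))
  triangulation : IsTriangulation poly triangles
  /-- the diagonals on which the guards are deployed -/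
  guards : Finset (Finset (Fin n))
  guards_diagonal : ∀ h ∈ guards, h.card = 2 ∧ ∃ t ∈ triangles, h ⊆ t

variable {n : ℕ}

namespace GuardedPolygon

/-- The triangles of the triangulation. -/
abbrev Tri (E : GuardedPolygon n) : Type := {t : Finset (Fin n) // t ∈ E.triangles}

/-- The guards. -/
abbrev Guard (E : GuardedPolygon n) : Type := {h : Finset (Fin n) // h ∈ E.guards}

/-- The closed triangle as a set of points. -/
def triSet (E : GuardedPolygon n) (t : E.Tri) : Set Plane := hull E.poly t.1

/-- The length of the diagonal of a guard (the distance of its two endpoints). -/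
def len (E : GuardedPolygon n) (g : E.Guard) : ℝ :=
  Metric.diam (E.poly.vertices '' (g.1 : Set (Fin n)))

/-- A guard is incident to a triangle if an endpoint of its diagonal is a vertex of the triangle. -/
def Incident (E : GuardedPolygon n) (g : E.Guard) (t : E.Tri) : Prop := ∃ w ∈ g.1, w ∈ t.1

/-- A triangle is safe if a guard is deployed on one of its edges. -/
def Safe (E : GuardedPolygon n) (t : E.Tri) : Prop := ∃ g : E.Guard, g.1 ⊆ t.1

end GuardedPolygon

/-! ### The sequential partitioning procedure -/

/-- State of the procedure. -/
structure State (E : GuardedPolygon n) where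
  /-- `first g = some u` if the regions of `g` have been computed, `u` being the endpoint of its
  diagonal that was treated first; `none` if `g` has not been allocated yet -/
  first : E.Guard → Option (Fin n)
  /-- the region assigned to a guard inside a triangle at its first endpoint -/
  R₁ : E.Guard → E.Tri → Set Plane
  /-- the region assigned to a guard inside a triangle at its second endpoint -/
  R₂ : E.Guard → E.Tri → Set Plane
  /-- pairs of a triangle and a guard such that the guard may no longer be assigned a region
  in the triangle -/
  deleted : Set (E.Tri × E.Guard)

namespace State

variable {E : GuardedPolygon n}

/-- The initial state: nothing has been assigned or deleted. -/
def init (E : GuardedPolygon n) : State E where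
  first := fun _ => none
  R₁ := fun _ _ => ∅
  R₂ := fun _ _ => ∅
  deleted := ∅

/-- `t` is a non-safe triangle with vertex `w`, and `g` may still be assigned a region in it.
Used when `w` is an endpoint of the diagonal of `g`. -/
def Available (s : State E) (g : E.Guard) (w : Fin n) (t : E.Tri) : Prop :=
  ¬ E.Safe t ∧ w ∈ t.1 ∧ (t, g) ∉ s.deleted

/-- The region of `g` in `t` at the second endpoint of `g` is already defined. -/
def SecondDefined (s : State E) (g : E.Guard) (t : E.Tri) : Prop :=
  ∃ u, s.first g = some u ∧ ∃ w ∈ g.1, w ≠ u ∧ s.Available g w t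

/-- The guard `g` is unallocated and ready with `u` as preferential endpoint: for each non-safe
triangle at `u` the second regions of all other guards incident to it are already defined
(in particular if all those triangles are incident to no other guard). -/
def Ready (s : State E) (g : E.Guard) (u : Fin n) : Prop :=
  s.first g = none ∧ u ∈ g.1 ∧ ∀ t : E.Tri, s.Available g u t →
    ∀ k : E.Guard, k ≠ g → E.Incident k t → (t, k) ∉ s.deleted → s.SecondDefined k t

/-- The part of the triangle `t` not yet assigned to a guard. -/
def free (s : State E) (t : E.Tri) : Set Plane :=
  E.triSet t \ ⋃ k : E.Guard, (s.R₁ k t ∪ s.R₂ k t)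

/-- The region of `g` in `t` when `u` is the first endpoint of `g`: the points of `t` outside the
second regions of all other guards incident to `t`. -/
def firstRegion (s : State E) (g : E.Guard) (u : Fin n) (t : E.Tri) : Set Plane :=
  {x | s.Available g u t ∧ x ∈ E.triSet t ∧
    ∀ k : E.Guard, k ≠ g → E.Incident k t → x ∉ s.R₂ k t}

/-- The union of the first regions of `g`. -/
def firstUnion (s : State E) (g : E.Guard) (u : Fin n) : Set Plane :=
  ⋃ t : E.Tri, s.firstRegion g u t

open Classical in
/-- The region of `g` in `t` at the endpoint different from `u`: the free points of `t` at distance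
at least `len g / r` from all points of the first regions. -/
def secondRegion (r : ℝ) (s : State E) (g : E.Guard) (u : Fin n) (t : E.Tri) : Set Plane :=
  if ∃ w ∈ g.1, w ≠ u ∧ s.Available g w t then
    if (s.firstUnion g u).Nonempty then
      (⋂ q ∈ s.firstUnion g u, (polyBall E.poly (E.len g / r) q)ᶜ) ∩ s.free t
    else s.free t
  else ∅

open Classical in
/-- Allocation of the guard `g` with first endpoint `u`. -/
def allocate (r : ℝ) (s : State E) (g : E.Guard) (u : Fin n) : State E where
  first := Function.update s.first g (some u)
  R₁ := Function.update s.R₁ g (s.firstRegion g u)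
  R₂ := Function.update s.R₂ g (s.secondRegion r g u)
  deleted := s.deleted

/-- Arbitrary choice of the guard `g` and its endpoint `u`: in each non-safe triangle at `u`, all
other unallocated guards incident to it are barred from being assigned a region. -/
def arbitrary (s : State E) (g : E.Guard) (u : Fin n) : State E where
  first := s.first
  R₁ := s.R₁
  R₂ := s.R₂
  deleted := s.deleted ∪ {x | ¬ E.Safe x.1 ∧ u ∈ x.1.1 ∧ x.2 ≠ g ∧ E.Incident x.2 x.1 ∧
    s.first x.2 = none}

/-- One step of the procedure with speed ratio `r`: a ready guard is allocated, or, if no guard is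
ready, an unallocated guard and one of its endpoints are chosen arbitrarily. -/
inductive Step (r : ℝ) : State E → State E → Prop
  | alloc (s : State E) (g : E.Guard) (u : Fin n) :
      s.Ready g u → Step r s (s.allocate r g u)
  | arbit (s : State E) (g : E.Guard) (u : Fin n) :
      (∀ k w, ¬ s.Ready k w) → s.first g = none → u ∈ g.1 → Step r s (s.arbitrary g u)

/-- The states that occur in runs of the procedure, for every choice the procedure leaves open. -/
def Reachable (r : ℝ) (s : State E) : Prop := Relation.ReflTransGen (Step r) (init E) s

/-- The union of the regions assigned to `g` at its first endpoint. -/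
def U₁ (s : State E) (g : E.Guard) : Set Plane := ⋃ t : E.Tri, s.R₁ g t

/-- The union of the regions assigned to `g` at its second endpoint. -/
def U₂ (s : State E) (g : E.Guard) : Set Plane := ⋃ t : E.Tri, s.R₂ g t

end State

end GuardTracking

end

namespace GuardTracking

open Filter Topology

/-! ### Sets described by the signs of finitely many circle or line equations -/

/-! Call a set tame if membership depends only on the signs of finitely many functions `a‖x‖² + b x₀
+ c x₁ + d`, whose zero sets are circles, lines and degenerate cases. The invariant is that every
region ever assigned is a tame subset of its triangle. Three facts carry the proof.

Bounded tame sets have the required boundary (`TameSet.boundedByArcs`). Off a finite set of critical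
zeros and of common zeros of non-proportional functions, the sign pattern near a point is that of a
single smooth curve. So the frontier is relatively open in each curve there, and its preimage under
a parametrization is a finite union of intervals.

Tame sets are closed under Boolean operations, which covers triangles, first regions and free parts,
and under closure.

The points of the polygon at polygon distance `< δ` from a tame `Q` form a tame set
(`IsTriangulation.tameSet_thickening`). A shortest chain either has a last vertex `v`, which gives a
disc about `v` cut by visibility from `v`, or it is a single visible segment. In the second case
take a nearest visible point `q` of `closure Q`. Unless `x` lies in `closure Q` or is near a vertex
as before, `q` is a frontier point and no vertex lies on the sight line. Visibility is then stable
near `q`, so `q` minimizes the distance locally on its curve: it is exceptional, or the foot of `x`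
on a line or circle. For such foot maps, distance, membership of the foot in `closure Q` and
visibility of the foot are all tame: offsets of lines and circles are again lines and circles, and
the remaining expressions factor into lines and circles (`TameFoot.line`, `TameFoot.circle`).

Stability of visibility needs the chain distance to be bounded by the length of every path through
triangles (`IsTriangulation.polyDist_le_pathLength`): a shortest path through a given triangle
sequence bends only at vertices. -/

/-- Coefficients of a function `a ‖x‖² + b x₀ + c x₁ + d` on the plane. -/
@[ext] structure Quad where
  /-- coefficient of `‖x‖²` -/
  a : ℝ
  /-- coefficient of the first coordinate -/
  b : ℝ
  /-- coefficient of the second coordinate -/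
  c : ℝ
  /-- constant coefficient -/
  d : ℝ

namespace Quad

/-- The value of the function with the given coefficients. -/
def eval (f : Quad) (x : Plane) : ℝ := f.a * (x 0 ^ 2 + x 1 ^ 2) + f.b * x 0 + f.c * x 1 + f.d

theorem continuous_eval (f : Quad) : Continuous f.eval := by
  unfold eval; fun_prop

end Quad

/-- A function on the plane that depends only on the signs of finitely many functions
`a ‖x‖² + b x₀ + c x₁ + d`. -/
def Tame {β : Type*} (φ : Plane → β) : Prop :=
  ∃ F : Set Quad, F.Finite ∧ ∀ x y : Plane,
    (∀ f ∈ F, SignType.sign (f.eval x) = SignType.sign (f.eval y)) → φ x = φ y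

/-- A set is tame if membership is. -/
def TameSet (U : Set Plane) : Prop := Tame (fun x => x ∈ U)

section Tame

variable {α β γ : Type*}

theorem Tame.const (b : β) : Tame (fun _ => b) := ⟨∅, Set.finite_empty, fun _ _ _ => rfl⟩

theorem Tame.comp {φ : Plane → β} (h : Tame φ) (k : β → γ) : Tame (fun x => k (φ x)) := by
  obtain ⟨F, hF, H⟩ := h
  exact ⟨F, hF, fun x y hxy => congrArg k (H x y hxy)⟩

theorem Tame.comp₂ {φ : Plane → α} {ψ : Plane → β} (h : Tame φ) (h' : Tame ψ) (k : α → β → γ) :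
    Tame (fun x => k (φ x) (ψ x)) := by
  obtain ⟨F, hF, H⟩ := h
  obtain ⟨F', hF', H'⟩ := h'
  refine ⟨F ∪ F', hF.union hF', fun x y hxy => ?_⟩
  have h1 := H x y fun f hf => hxy f (Or.inl hf)
  have h2 := H' x y fun f hf => hxy f (Or.inr hf)
  simp only [h1, h2]

theorem Tame.pi {ι : Type*} [Finite ι] {φ : ι → Plane → β} (h : ∀ i, Tame (φ i)) :
    Tame (fun x i => φ i x) := by
  choose F hF H using h
  refine ⟨⋃ i, F i, Set.finite_iUnion hF, fun x y hxy => ?_⟩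
  funext i
  exact H i x y fun f hf => hxy f (Set.mem_iUnion.2 ⟨i, hf⟩)

theorem Tame.sign_eval (f : Quad) : Tame (fun x => SignType.sign (f.eval x)) :=
  ⟨{f}, Set.finite_singleton f, fun _ _ h => h f rfl⟩

theorem TameSet.union {U V : Set Plane} (hU : TameSet U) (hV : TameSet V) : TameSet (U ∪ V) :=
  hU.comp₂ hV Or

theorem TameSet.inter {U V : Set Plane} (hU : TameSet U) (hV : TameSet V) : TameSet (U ∩ V) :=
  hU.comp₂ hV And

theorem TameSet.compl {U : Set Plane} (hU : TameSet U) : TameSet Uᶜ := hU.comp Not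

theorem TameSet.diff {U V : Set Plane} (hU : TameSet U) (hV : TameSet V) : TameSet (U \ V) :=
  hU.inter hV.compl

theorem TameSet.empty : TameSet ∅ := Tame.const False

theorem TameSet.iUnion {ι : Type*} [Finite ι] {U : ι → Set Plane} (h : ∀ i, TameSet (U i)) :
    TameSet (⋃ i, U i) := by
  have := (Tame.pi h).comp (fun P : ι → Prop => ∃ i, P i)
  simpa [TameSet, Set.mem_iUnion] using this

theorem TameSet.biUnion {ι : Type*} {s : Set ι} (hs : s.Finite) {U : ι → Set Plane}
    (h : ∀ i ∈ s, TameSet (U i)) : TameSet (⋃ i ∈ s, U i) := by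
  have := hs.to_subtype
  rw [Set.biUnion_eq_iUnion]
  exact TameSet.iUnion fun i => h i i.2

theorem Tame.mul {h k : Plane → ℝ} (hh : Tame (fun x => SignType.sign (h x)))
    (hk : Tame (fun x => SignType.sign (k x))) : Tame (fun x => SignType.sign (h x * k x)) := by
  simp only [sign_mul]
  exact hh.comp₂ hk (· * ·)

theorem Tame.sign_const (b : ℝ) : Tame (fun _ => SignType.sign b) := Tame.const _

theorem TameSet.pos {h : Plane → ℝ} (hh : Tame (fun x => SignType.sign (h x))) :
    TameSet {x | 0 < h x} := by
  have := hh.comp (fun s => s = 1)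
  simpa [TameSet, sign_eq_one_iff] using this

/-- The circle function `‖x - c‖² - k`. -/
def Quad.circle (c : Plane) (k : ℝ) : Quad := ⟨1, -2 * c 0, -2 * c 1, c 0 ^ 2 + c 1 ^ 2 - k⟩

theorem dist_sq_eq (x y : Plane) : dist x y ^ 2 = (x 0 - y 0) ^ 2 + (x 1 - y 1) ^ 2 := by
  rw [EuclideanSpace.dist_eq, Real.sq_sqrt (by positivity)]
  simp [Fin.sum_univ_two, Real.dist_eq, sq_abs]

theorem Quad.eval_circle (c : Plane) (k : ℝ) (x : Plane) :
    (Quad.circle c k).eval x = dist x c ^ 2 - k := by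
  rw [dist_sq_eq]; simp only [Quad.circle, Quad.eval]; ring

theorem TameSet.singleton (c : Plane) : TameSet {c} := by
  have := (Tame.sign_eval (Quad.circle c 0)).comp (fun s => s = 0)
  simpa [TameSet, Quad.eval_circle, sign_eq_zero_iff] using this

theorem TameSet.finite {X : Set Plane} (hX : X.Finite) : TameSet X := by
  rw [← Set.biUnion_of_singleton X]
  exact TameSet.biUnion hX fun c _ => TameSet.singleton c

/-- Changing a function at finitely many points does not affect tameness. -/
theorem Tame.congr_off_finite {φ ψ : Plane → β} (h : Tame ψ) {X : Set Plane} (hX : X.Finite)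
    (H : ∀ x ∉ X, φ x = ψ x) : Tame φ := by
  obtain ⟨F, hF, hψ⟩ := h
  refine ⟨F ∪ (fun c => Quad.circle c 0) '' X, hF.union (hX.image _), fun x y hxy => ?_⟩
  have key : ∀ c ∈ X, x = c ↔ y = c := fun c hc => by
    have := hxy _ (Or.inr ⟨c, hc, rfl⟩)
    simp only [Quad.eval_circle, sub_zero] at this
    have h0 : SignType.sign (dist x c ^ 2) = 0 ↔ SignType.sign (dist y c ^ 2) = 0 := by rw [this]
    simpa [sign_eq_zero_iff] using h0
  by_cases hx : x ∈ X
  · rw [(key x hx).1 rfl]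
  · have hy : y ∉ X := fun hy => hx (by rw [(key y hy).2 rfl]; exact hy)
    rw [H x hx, H y hy]
    exact hψ x y fun f hf => hxy f (Or.inl hf)

theorem TameSet.ball (c : Plane) (δ : ℝ) : TameSet {x | dist x c < δ} := by
  rcases le_or_gt δ 0 with h | h
  · have : {x | dist x c < δ} = ∅ := by
      ext x; simp only [Set.mem_ofPred_eq, Set.mem_empty_iff_false, iff_false, not_lt]
      exact h.trans dist_nonneg
    rw [this]; exact TameSet.empty
  · have := (Tame.sign_eval (Quad.circle c (δ ^ 2))).comp (fun s => s = -1)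
    simp only [Quad.eval_circle, sign_eq_neg_one_iff, sub_neg] at this
    refine (congrArg Tame (funext fun x => propext ?_)).mp this
    rw [sq_lt_sq₀ dist_nonneg h.le]; rfl

end Tame

/-! ### Affine functions -/

/-- A function on the plane that is affine in the coordinates. -/
def IsAff (h : Plane → ℝ) : Prop := ∃ b c d : ℝ, ∀ x : Plane, h x = b * x 0 + c * x 1 + d

namespace IsAff

variable {h k : Plane → ℝ}

theorem const (d : ℝ) : IsAff fun _ => d := ⟨0, 0, d, by simp⟩

theorem coord (i : Fin 2) : IsAff fun x => x i := by
  fin_cases i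
  · exact ⟨1, 0, 0, by simp⟩
  · exact ⟨0, 1, 0, by simp⟩

theorem add (hh : IsAff h) (hk : IsAff k) : IsAff fun x => h x + k x := by
  obtain ⟨b, c, d, H⟩ := hh
  obtain ⟨b', c', d', H'⟩ := hk
  exact ⟨b + b', c + c', d + d', fun x => by simp only [H, H']; ring⟩

theorem const_mul (s : ℝ) (hh : IsAff h) : IsAff fun x => s * h x := by
  obtain ⟨b, c, d, H⟩ := hh
  exact ⟨s * b, s * c, s * d, fun x => by simp only [H]; ring⟩

theorem sub (hh : IsAff h) (hk : IsAff k) : IsAff fun x => h x - k x := by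
  simpa [sub_eq_add_neg] using hh.add (hk.const_mul (-1))

theorem tame (hh : IsAff h) : Tame fun x => SignType.sign (h x) := by
  obtain ⟨b, c, d, H⟩ := hh
  have := Tame.sign_eval ⟨0, b, c, d⟩
  simpa [Quad.eval, ← H] using this

end IsAff

/-- The sign of a binary quadratic form in two affine functions is tame. -/
theorem Tame.quadForm {u w : Plane → ℝ} (hu : IsAff u) (hw : IsAff w) (A B C : ℝ) :
    Tame fun x => SignType.sign (A * u x ^ 2 + B * (u x * w x) + C * w x ^ 2) := by
  by_cases hA : A = 0
  · have := (hw.tame).mul ((hu.const_mul B).add (hw.const_mul C)).tame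
    refine (congrArg Tame (funext fun x => ?_)).mp this
    congr 1; rw [hA]; ring
  -- Complete the square: `4A` times the form is `(2Au + Bw)² - D w²`. For `D ≥ 0` this splits into
  -- two affine factors; for `D < 0` it is positive except where both squares vanish.
  set D : ℝ := B ^ 2 - 4 * A * C with hD
  have hX : IsAff fun x => 2 * A * u x + B * w x := (hu.const_mul (2 * A)).add (hw.const_mul B)
  have key : Tame fun x => SignType.sign ((2 * A * u x + B * w x) ^ 2 - D * w x ^ 2) := by
    rcases le_or_gt 0 D with h0 | h0
    · have := (hX.sub (hw.const_mul √D)).tame.mul (hX.add (hw.const_mul √D)).tame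
      refine (congrArg Tame (funext fun x => ?_)).mp this
      congr 1
      linear_combination (-(w x ^ 2)) * Real.sq_sqrt h0
    · have := hX.tame.comp₂ hw.tame (fun s t => if s = 0 ∧ t = 0 then (0 : SignType) else 1)
      refine (congrArg Tame (funext fun x => ?_)).mp this
      simp only [sign_eq_zero_iff]
      split_ifs with h
      · rw [h.1, h.2]; simp
      · symm; rw [sign_eq_one_iff]
        by_cases hw0 : w x = 0
        · have h1 : 2 * A * u x + B * w x ≠ 0 := fun h1 => h ⟨h1, hw0⟩
          rw [hw0] at h1 ⊢
          have := pow_pos (abs_pos.2 h1) 2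
          rw [sq_abs] at this
          simpa using this
        · have := mul_pos (neg_pos.2 h0) (pow_pos (abs_pos.2 hw0) 2)
          rw [sq_abs] at this
          nlinarith [sq_nonneg (2 * A * u x + B * w x)]
  have := (Tame.sign_const (4 * A)).mul key
  refine (congrArg Tame (funext fun x => ?_)).mp this
  have e : 4 * A * ((2 * A * u x + B * w x) ^ 2 - D * w x ^ 2) =
      (4 * A) ^ 2 * (A * u x ^ 2 + B * (u x * w x) + C * w x ^ 2) := by rw [hD]; ring
  rw [e, sign_mul, sign_eq_one_iff.2 (by positivity : (0 : ℝ) < (4 * A) ^ 2), one_mul]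

/-- The sign of a sum is determined by the signs of the summands and of the difference of their
squares. -/
theorem sign_add_congr {u w u' w' : ℝ} (h1 : SignType.sign u = SignType.sign u')
    (h2 : SignType.sign w = SignType.sign w')
    (h3 : SignType.sign (u ^ 2 - w ^ 2) = SignType.sign (u' ^ 2 - w' ^ 2)) :
    SignType.sign (u + w) = SignType.sign (u' + w') := by
  -- If `u` and `w` have opposite signs, the sign of `u - w` is known and can be cancelled from `(u
  -- - w)(u + w)`; otherwise the sign of the sum is immediate.
  have e : ∀ u w : ℝ, u ^ 2 - w ^ 2 = (u - w) * (u + w) := fun u w => by ring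
  rw [e, e, sign_mul, sign_mul] at h3
  rcases lt_trichotomy u 0 with hu | hu | hu
  · have hu' : u' < 0 := by rwa [sign_neg hu, eq_comm, sign_eq_neg_one_iff] at h1
    rcases lt_or_ge 0 w with hw | hw
    · have hw' : 0 < w' := by rwa [sign_pos hw, eq_comm, sign_eq_one_iff] at h2
      rw [sign_neg (by linarith : u - w < 0), sign_neg (by linarith : u' - w' < 0)] at h3
      simpa using h3
    · have hw' : w' ≤ 0 := by
        by_contra h
        rw [sign_pos (not_le.1 h), sign_eq_one_iff] at h2; linarith
      rw [sign_neg (by linarith), sign_neg (by linarith)]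
  · have hu' : u' = 0 := by rwa [hu, sign_zero, eq_comm, sign_eq_zero_iff] at h1
    rw [hu, hu', zero_add, zero_add, h2]
  · have hu' : 0 < u' := by rwa [sign_pos hu, eq_comm, sign_eq_one_iff] at h1
    rcases lt_or_ge w 0 with hw | hw
    · have hw' : w' < 0 := by rwa [sign_neg hw, eq_comm, sign_eq_neg_one_iff] at h2
      rw [sign_pos (by linarith : 0 < u - w), sign_pos (by linarith : 0 < u' - w')] at h3
      simpa using h3
    · have hw' : 0 ≤ w' := by
        by_contra h
        rw [sign_neg (not_le.1 h), sign_eq_neg_one_iff] at h2; linarith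
      rw [sign_pos (by linarith), sign_pos (by linarith)]

/-- Squaring removes a root: for `u` a multiple of a distance and `w` affine, `u² - w²` is a
polynomial. -/
theorem Tame.add_of_sq {u w : Plane → ℝ} (hu : Tame fun x => SignType.sign (u x))
    (hw : Tame fun x => SignType.sign (w x))
    (huw : Tame fun x => SignType.sign (u x ^ 2 - w x ^ 2)) :
    Tame fun x => SignType.sign (u x + w x) := by
  obtain ⟨F, hF, H⟩ := (hu.comp₂ hw Prod.mk).comp₂ huw Prod.mk
  refine ⟨F, hF, fun x y hxy => ?_⟩
  have := H x y hxy
  simp only [Prod.mk.injEq] at this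
  exact sign_add_congr this.1.1 this.1.2 this.2

/-- The sign of `α ‖x - c‖ + β₀ (x₀ - c₀) + β₁ (x₁ - c₁)` is tame. -/
theorem Tame.cone (c : Plane) (α β₀ β₁ : ℝ) :
    Tame fun x => SignType.sign (α * dist x c + (β₀ * (x 0 - c 0) + β₁ * (x 1 - c 1))) := by
  have h0 : IsAff fun x => x 0 - c 0 := (IsAff.coord 0).sub (IsAff.const _)
  have h1 : IsAff fun x => x 1 - c 1 := (IsAff.coord 1).sub (IsAff.const _)
  refine Tame.add_of_sq ?_ ((h0.const_mul β₀).add (h1.const_mul β₁)).tame ?_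
  · refine (Tame.sign_const α).mul ?_
    have := Tame.sign_eval (Quad.circle c 0)
    refine (congrArg Tame (funext fun x => ?_)).mp this
    rw [Quad.eval_circle, sub_zero]
    rcases dist_nonneg (x := x) (y := c) |>.eq_or_lt with h | h
    · simp [← h]
    · rw [sign_pos h, sign_pos (by positivity)]
  -- With the apex at `c`, the difference of squares is homogeneous in `x - c`, so it is governed by
  -- lines through `c`. A constant term would produce a genuine conic.
  · have := Tame.quadForm h0 h1 (α ^ 2 - β₀ ^ 2) (-2 * β₀ * β₁) (α ^ 2 - β₁ ^ 2)
    refine (congrArg Tame (funext fun x => ?_)).mp this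
    congr 1
    rw [mul_pow, dist_sq_eq]; ring

/-! ### Intersections of zero sets -/

theorem finite_quadratic_roots {A B C : ℝ} (h : ¬ (A = 0 ∧ B = 0 ∧ C = 0)) :
    {t : ℝ | A * t ^ 2 + B * t + C = 0}.Finite := by
  set p : Polynomial ℝ := Polynomial.C A * Polynomial.X ^ 2 + Polynomial.C B * Polynomial.X +
    Polynomial.C C with hp
  have hp0 : p ≠ 0 := by
    intro h0
    apply h
    have h2 := congrArg (fun q => Polynomial.coeff q 2) h0
    have h1 := congrArg (fun q => Polynomial.coeff q 1) h0
    have h0 := congrArg (fun q => Polynomial.coeff q 0) h0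
    simp [hp, Polynomial.coeff_X, Polynomial.coeff_C] at h0 h1 h2
    exact ⟨h2, h1, h0⟩
  refine (p.roots.toFinset.finite_toSet).subset fun t ht => ?_
  rw [Finset.mem_coe, Multiset.mem_toFinset, Polynomial.mem_roots hp0]
  simpa [hp, Polynomial.IsRoot] using ht

namespace Quad

/-- `g` is a multiple of `f`. -/
def IsMultiple (f g : Quad) : Prop :=
  ∃ k : ℝ, g.a = k * f.a ∧ g.b = k * f.b ∧ g.c = k * f.c ∧ g.d = k * f.d

theorem IsMultiple.eval {f g : Quad} (h : IsMultiple f g) : ∃ k : ℝ, ∀ x, g.eval x = k * f.eval x := by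
  obtain ⟨k, h1, h2, h3, h4⟩ := h
  exact ⟨k, fun x => by simp only [Quad.eval, h1, h2, h3, h4]; ring⟩

/-- In the coordinate `t = -c x₀ + b x₁` along the line, `g` becomes a quadratic polynomial with
coefficients `a'/m`, `B`, `C`. If all three vanish, `g` is a multiple of `f`, the factor being read
off from the components of its gradient along the normal. -/
theorem finite_inter_of_line {f g : Quad} (ha : f.a = 0) (hbc : ¬ (f.b = 0 ∧ f.c = 0))
    (h : ¬ IsMultiple f g) : {x | f.eval x = 0 ∧ g.eval x = 0}.Finite := by
  obtain ⟨a, b, c, d⟩ := f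
  obtain ⟨a', b', c', d'⟩ := g
  simp only at ha hbc
  subst ha
  set m := b ^ 2 + c ^ 2 with hm
  have hm0 : m ≠ 0 := by
    intro h0; apply hbc; constructor <;> nlinarith [sq_nonneg b, sq_nonneg c]
  set B := (b * c' - c * b') / m with hB
  set C := a' * d ^ 2 / m - (b * b' + c * c') * d / m + d' with hC
  have hroots : ¬ (a' / m = 0 ∧ B = 0 ∧ C = 0) := by
    rintro ⟨h1, h2, h3⟩
    have h1 : a' = 0 := by simpa [hm0] using h1
    have h2 : b * c' - c * b' = 0 := by simpa [hB, hm0] using h2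
    apply h
    refine ⟨(b * b' + c * c') / m, ?_, ?_, ?_, ?_⟩ <;> simp only
    · rw [h1]; ring
    · field_simp; linear_combination b' * hm - c * h2
    · field_simp; linear_combination c' * hm + b * h2
    · rw [hC, h1] at h3; linear_combination h3
  refine ((finite_quadratic_roots hroots).image
    (fun t => (!₂[(-d * b - c * t) / m, (-d * c + b * t) / m] : Plane))).subset ?_
  rintro x ⟨hf, hg⟩
  simp only [Quad.eval] at hf hg
  have e0 : (-d * b - c * (-c * x 0 + b * x 1)) / m = x 0 := by
    rw [div_eq_iff hm0, hm]; linear_combination (-b) * hf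
  have e1 : (-d * c + b * (-c * x 0 + b * x 1)) / m = x 1 := by
    rw [div_eq_iff hm0, hm]; linear_combination (-c) * hf
  refine ⟨-c * x 0 + b * x 1, ?_, ?_⟩
  · set t := -c * x 0 + b * x 1 with ht
    rw [← e0, ← e1] at hg
    simp only [Set.mem_ofPred_eq]
    rw [← hg, hB, hC]
    field_simp
    rw [hm]
    ring
  · ext i; fin_cases i
    · simpa using e0
    · simpa using e1

/-- When `f` has a quadratic part, `f.a • g - g.a • f` is the radical axis: it has no quadratic part
and vanishes at all common zeros, which reduces the claim to a line or to a nonzero constant. -/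
theorem finite_inter {f g : Quad} (hf : f ≠ ⟨0, 0, 0, 0⟩) (h : ¬ IsMultiple f g) :
    {x | f.eval x = 0 ∧ g.eval x = 0}.Finite := by
  by_cases ha : f.a = 0
  · by_cases hbc : f.b = 0 ∧ f.c = 0
    · have hd : f.d ≠ 0 := fun hd => hf (by ext <;> simp [ha, hbc, hd])
      convert Set.finite_empty using 1
      ext x
      simp [Quad.eval, ha, hbc, hd]
    · exact finite_inter_of_line ha hbc h
  · set k : Quad := ⟨0, f.a * g.b - g.a * f.b, f.a * g.c - g.a * f.c, f.a * g.d - g.a * f.d⟩ with hk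
    have hsub : {x | f.eval x = 0 ∧ g.eval x = 0} ⊆ {x | k.eval x = 0 ∧ f.eval x = 0} := by
      rintro x ⟨h1, h2⟩
      refine ⟨?_, h1⟩
      simp only [Quad.eval, hk] at h1 h2 ⊢
      linear_combination f.a * h2 - g.a * h1
    refine Set.Finite.subset ?_ hsub
    by_cases hbc : k.b = 0 ∧ k.c = 0
    · by_cases hd : k.d = 0
      · exact absurd ⟨g.a / f.a, by field_simp, by
          field_simp; linear_combination hbc.1, by
          field_simp; linear_combination hbc.2, by field_simp; linear_combination hd⟩ h
      · convert Set.finite_empty using 1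
        ext x
        have : k.a = 0 := rfl
        simp [Quad.eval, this, hbc, hd]
    · refine finite_inter_of_line rfl hbc ?_
      rintro ⟨s, h1, -⟩
      exact ha (by rw [h1]; simp [hk])

/-- The gradient vanishes. -/
def Critical (f : Quad) (x : Plane) : Prop := 2 * f.a * x 0 + f.b = 0 ∧ 2 * f.a * x 1 + f.c = 0

/-- A function without quadratic part has constant gradient; with one, the gradient vanishes only at
the centre. -/
theorem finite_critical {f : Quad} (hf : f ≠ ⟨0, 0, 0, 0⟩) :
    {x | f.eval x = 0 ∧ f.Critical x}.Finite := by
  by_cases ha : f.a = 0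
  · convert Set.finite_empty using 1
    ext x
    simp only [Critical, ha, Set.mem_ofPred_eq, Set.mem_empty_iff_false, iff_false]
    rintro ⟨h, h1, h2⟩
    have hb : f.b = 0 := by linarith
    have hc : f.c = 0 := by linarith
    apply hf
    ext
    · exact ha
    · exact hb
    · exact hc
    · simpa [Quad.eval, ha, hb, hc] using h
  · refine (Set.finite_singleton (!₂[-f.b / (2 * f.a), -f.c / (2 * f.a)] : Plane)).subset ?_
    rintro x ⟨-, h1, h2⟩
    rw [Set.mem_singleton_iff]
    ext i; fin_cases i
    · simp; field_simp; linarith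
    · simp; field_simp; linarith

/-- Near a noncritical zero every sign occurs. -/
theorem frequently_sign_eq {f : Quad} {x : Plane} (h0 : f.eval x = 0) (hc : ¬ f.Critical x)
    (s : SignType) : ∃ᶠ y in 𝓝 x, SignType.sign (f.eval y) = s := by
  set g0 := 2 * f.a * x 0 + f.b with hg0
  set g1 := 2 * f.a * x 1 + f.c with hg1
  have hm : 0 < g0 ^ 2 + g1 ^ 2 := by
    by_contra hm
    exact hc ⟨by nlinarith [sq_nonneg g0, sq_nonneg g1], by nlinarith [sq_nonneg g0, sq_nonneg g1]⟩
  -- Along the gradient direction `f` equals `t` times a factor that is positive for small `t`, so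
  -- its sign is the sign of `t`.
  set γ : ℝ → Plane := fun t => x + t • !₂[g0, g1] with hγ
  have hγc : Tendsto γ (𝓝 0) (𝓝 x) := by
    have : Continuous γ := by fun_prop
    simpa [hγ] using this.tendsto 0
  have hev : ∀ t, f.eval (γ t) = t * ((g0 ^ 2 + g1 ^ 2) * (1 + f.a * t)) := fun t => by
    simp only [Quad.eval] at h0
    simp only [hγ, Quad.eval, PiLp.add_apply, PiLp.smul_apply, smul_eq_mul]
    simp
    linear_combination h0 + t * g0 * hg0.symm + t * g1 * hg1.symm
  have hpos : ∀ᶠ t : ℝ in 𝓝 0, 0 < (g0 ^ 2 + g1 ^ 2) * (1 + f.a * t) := by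
    have : Tendsto (fun t : ℝ => (g0 ^ 2 + g1 ^ 2) * (1 + f.a * t)) (𝓝 0)
        (𝓝 ((g0 ^ 2 + g1 ^ 2) * (1 + f.a * 0))) := (by fun_prop : Continuous _).tendsto 0
    exact this.eventually_const_lt (by simpa using hm)
  have hsign : ∀ᶠ t : ℝ in 𝓝 0, SignType.sign (f.eval (γ t)) = SignType.sign t := by
    filter_upwards [hpos] with t ht
    rw [hev, sign_mul, sign_pos ht, mul_one]
  have hfreq : ∃ᶠ t : ℝ in 𝓝 0, SignType.sign t = s := by
    rcases s with _ | _ | _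
    · exact mem_closure_iff_frequently.1 (by simp : (0 : ℝ) ∈ closure {t | SignType.sign t = 0})
    · have : (0 : ℝ) ∈ closure (Set.Iio 0) := by simp
      refine (mem_closure_iff_frequently.1 this).mono fun t ht => sign_neg ht
    · have : (0 : ℝ) ∈ closure (Set.Ioi 0) := by simp
      refine (mem_closure_iff_frequently.1 this).mono fun t ht => sign_pos ht
  exact hγc.frequently ((hfreq.and_eventually hsign).mono fun t ht => ht.2.trans ht.1)

end Quad

/-- Outside a finite set, the zeros of finitely many functions are noncritical, and two functions
with a common zero are proportional. -/
theorem exists_exceptional {F : Set Quad} (hF : F.Finite) :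
    ∃ E : Set Plane, E.Finite ∧ ∀ x ∉ E, ∀ f ∈ F, f ≠ ⟨0, 0, 0, 0⟩ → f.eval x = 0 →
      ¬ f.Critical x ∧ ∀ g ∈ F, g.eval x = 0 → ∃ k : ℝ, ∀ y, g.eval y = k * f.eval y := by
  classical
  refine ⟨(⋃ f ∈ F, if f = ⟨0, 0, 0, 0⟩ then ∅ else {x | f.eval x = 0 ∧ f.Critical x}) ∪
    ⋃ f ∈ F, ⋃ g ∈ F, if f = ⟨0, 0, 0, 0⟩ ∨ f.IsMultiple g then ∅ else
      {x | f.eval x = 0 ∧ g.eval x = 0}, ?_, ?_⟩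
  · refine (hF.biUnion fun f _ => ?_).union (hF.biUnion fun f _ => hF.biUnion fun g _ => ?_)
    · split_ifs with h
      · exact Set.finite_empty
      · exact Quad.finite_critical h
    · split_ifs with h
      · exact Set.finite_empty
      · rw [not_or] at h
        exact Quad.finite_inter h.1 h.2
  · intro x hx f hf hf0 hfx
    rw [Set.mem_union, not_or] at hx
    refine ⟨fun hc => hx.1 ?_, fun g hg hgx => ?_⟩
    · simp only [Set.mem_iUnion]
      exact ⟨f, hf, by rw [if_neg hf0]; exact ⟨hfx, hc⟩⟩
    · by_contra hk
      refine hx.2 ?_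
      simp only [Set.mem_iUnion]
      refine ⟨f, hf, g, hg, ?_⟩
      rw [if_neg]
      · exact ⟨hfx, hgx⟩
      · rintro (h | h)
        · exact hf0 h
        · exact hk h.eval

/-! ### Local structure and closure of tame sets -/

theorem eventually_sign_eq {F : Set Quad} (hF : F.Finite) (x : Plane) :
    ∀ᶠ y in 𝓝 x, ∀ f ∈ F, f.eval x ≠ 0 → SignType.sign (f.eval y) = SignType.sign (f.eval x) := by
  rw [eventually_all_finite hF]
  intro f _
  rcases lt_trichotomy (f.eval x) 0 with h | h | h
  · filter_upwards [f.continuous_eval.continuousAt.eventually_lt_const h] with y hy _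
    rw [sign_neg hy, sign_neg h]
  · exact Eventually.of_forall fun y h' => absurd h h'
  · filter_upwards [f.continuous_eval.continuousAt.eventually_const_lt h] with y hy _
    rw [sign_pos hy, sign_pos h]

theorem Quad.eval_zero (x : Plane) : Quad.eval ⟨0, 0, 0, 0⟩ x = 0 := by simp [Quad.eval]

/-- Away from the exceptional points, membership in the closure depends on the signs only. -/
theorem mem_closure_of_sign_eq {F : Set Quad} (hF : F.Finite) {E : Set Plane}
    (hE : ∀ x ∉ E, ∀ f ∈ F, f ≠ ⟨0, 0, 0, 0⟩ → f.eval x = 0 →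
      ¬ f.Critical x ∧ ∀ g ∈ F, g.eval x = 0 → ∃ k : ℝ, ∀ y, g.eval y = k * f.eval y)
    {Q : Set Plane} (hQ : ∀ x y : Plane,
      (∀ f ∈ F, SignType.sign (f.eval x) = SignType.sign (f.eval y)) → (x ∈ Q) = (y ∈ Q))
    {x y : Plane} (hx : x ∉ E) (hy : y ∉ E)
    (hxy : ∀ f ∈ F, SignType.sign (f.eval x) = SignType.sign (f.eval y)) (h : x ∈ closure Q) :
    y ∈ closure Q := by
  have hz : ∀ f ∈ F, f.eval x = 0 ↔ f.eval y = 0 := fun f hf => by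
    rw [← sign_eq_zero_iff, hxy f hf, sign_eq_zero_iff]
  have hfreq := mem_closure_iff_frequently.1 h
  obtain ⟨x', hx', hs⟩ := (hfreq.and_eventually (eventually_sign_eq hF x)).exists
  -- On a curve `f = 0`, every member of `F` vanishing at `x` is a multiple of `f`, and the others
  -- keep their sign. The sign vector of the nearby point `x'` of `Q` is thus fixed by the sign of
  -- `f` there, and this sign also occurs arbitrarily close to `y`. Off all curves the sign vector
  -- is locally constant.
  by_cases hA : ∃ f ∈ F, f ≠ ⟨0, 0, 0, 0⟩ ∧ f.eval x = 0
  · obtain ⟨f, hf, hf0, hfx⟩ := hA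
    obtain ⟨-, hmul⟩ := hE x hx f hf hf0 hfx
    obtain ⟨hcrit, -⟩ := hE y hy f hf hf0 ((hz f hf).1 hfx)
    have h2 := (Quad.frequently_sign_eq ((hz f hf).1 hfx) hcrit
      (SignType.sign (f.eval x'))).and_eventually (eventually_sign_eq hF y)
    refine mem_closure_iff_frequently.2 (h2.mono ?_)
    rintro y' ⟨h3, h4⟩
    rw [← hQ x' y']
    · exact hx'
    intro g hg
    by_cases hgx : g.eval x = 0
    · obtain ⟨k, hk⟩ := hmul g hg hgx
      rw [hk, hk, sign_mul, sign_mul, h3]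
    · rw [hs g hg hgx, h4 g hg (fun h => hgx ((hz g hg).2 h)), hxy g hg]
  · push Not at hA
    have : x ∈ Q := by
      rw [← hQ x' x]
      · exact hx'
      intro g hg
      by_cases hg0 : g = ⟨0, 0, 0, 0⟩
      · rw [hg0, Quad.eval_zero, Quad.eval_zero]
      · exact hs g hg (hA g hg hg0)
    exact subset_closure (by rw [← hQ x y hxy]; exact this)

/-- The structure of the boundary of a tame set: away from a finite set `E`, the boundary is a
union of relatively open parts of finitely many curves. -/
theorem TameSet.frontier_structure {Q : Set Plane} (h : TameSet Q) :
    ∃ (F : Set Quad) (E : Set Plane), F.Finite ∧ E.Finite ∧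
      (∀ x ∈ frontier Q, ∃ f ∈ F, f ≠ ⟨0, 0, 0, 0⟩ ∧ f.eval x = 0) ∧
      (∀ f ∈ F, f ≠ ⟨0, 0, 0, 0⟩ → ∀ x ∉ E, f.eval x = 0 → ¬ f.Critical x) ∧
      (∀ f ∈ F, f ≠ ⟨0, 0, 0, 0⟩ → ∀ x ∉ E, f.eval x = 0 → x ∈ frontier Q →
        ∀ᶠ y in 𝓝 x, f.eval y = 0 → y ∈ frontier Q) ∧
      (∀ x y : Plane, x ∉ E → y ∉ E →
        (∀ f ∈ F, SignType.sign (f.eval x) = SignType.sign (f.eval y)) →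
        (x ∈ closure Q ↔ y ∈ closure Q)) := by
  obtain ⟨F, hF, hQ⟩ := h
  obtain ⟨E, hEf, hE⟩ := exists_exceptional hF
  have hQc : ∀ x y : Plane, (∀ f ∈ F, SignType.sign (f.eval x) = SignType.sign (f.eval y)) →
      (x ∈ Qᶜ) = (y ∈ Qᶜ) := fun x y hxy => congrArg Not (hQ x y hxy)
  refine ⟨F, E, hF, hEf, ?_, fun f hf hf0 x hx hfx => (hE x hx f hf hf0 hfx).1, ?_, ?_⟩
  · intro x hx
    by_contra hA
    push Not at hA
    have hloc : ∀ᶠ y in 𝓝 x, (y ∈ Q) = (x ∈ Q) := by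
      filter_upwards [eventually_sign_eq hF x] with y hy
      refine hQ y x fun g hg => ?_
      by_cases hg0 : g = ⟨0, 0, 0, 0⟩
      · rw [hg0, Quad.eval_zero, Quad.eval_zero]
      · exact hy g hg (hA g hg hg0)
    rw [frontier_eq_closure_inter_closure] at hx
    obtain ⟨y, hy, hy'⟩ := ((mem_closure_iff_frequently.1 hx.1).and_eventually hloc).exists
    obtain ⟨z, hz, hz'⟩ := ((mem_closure_iff_frequently.1 hx.2).and_eventually hloc).exists
    exact hz (by rw [hz', ← hy']; exact hy)
  · intro f hf hf0 x hx hfx hxQ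
    have hEc : ∀ᶠ y in 𝓝 x, y ∉ E := hEf.isClosed.isOpen_compl.mem_nhds hx
    obtain ⟨-, hmul⟩ := hE x hx f hf hf0 hfx
    filter_upwards [hEc, eventually_sign_eq hF x] with y hyE hs hfy
    -- A nearby zero of `f` has the same sign vector as `x`, so it lies in the closures of `Q` and
    -- of its complement exactly when `x` does.
    have hxy : ∀ g ∈ F, SignType.sign (g.eval x) = SignType.sign (g.eval y) := fun g hg => by
      by_cases hgx : g.eval x = 0
      · obtain ⟨k, hk⟩ := hmul g hg hgx
        rw [hk, hk, hfx, hfy]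
      · exact (hs g hg hgx).symm
    rw [frontier_eq_closure_inter_closure] at hxQ ⊢
    exact ⟨mem_closure_of_sign_eq hF hE hQ hx hyE hxy hxQ.1,
      mem_closure_of_sign_eq hF hE hQc hx hyE hxy hxQ.2⟩
  · intro x y hx hy hxy
    exact ⟨mem_closure_of_sign_eq hF hE hQ hx hy hxy,
      mem_closure_of_sign_eq hF hE hQ hy hx fun f hf => (hxy f hf).symm⟩

/-- Off `E`, membership in the closure is a function of the sign vector, evaluated at any
representative outside `E`; the finitely many points of `E` do not affect tameness. -/
theorem TameSet.closure {Q : Set Plane} (h : TameSet Q) : TameSet (closure Q) := by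
  obtain ⟨F, E, hF, hE, -, -, -, H⟩ := h.frontier_structure
  have hT : Tame fun x (c : F) => SignType.sign (c.1.eval x) := by
    have := hF.to_subtype
    exact Tame.pi fun c => Tame.sign_eval c.1
  have hT' := hT.comp fun σ => ∃ y ∉ E, (∀ f : F, SignType.sign (f.1.eval y) = σ f) ∧
    y ∈ _root_.closure Q
  refine Tame.congr_off_finite hT' hE fun x hx => propext ⟨fun h => ⟨x, hx, fun _ => rfl, h⟩, ?_⟩
  rintro ⟨y, hy, h1, h2⟩
  exact (H y x hy hx fun f hf => h1 ⟨f, hf⟩).1 h2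

/-! ### Bounded tame sets are bounded by arcs -/

/-- A compact set of reals with finite boundary is a finite union of closed intervals. -/
theorem exists_finite_Icc {G : Set ℝ} (hG : IsCompact G) (hf : (frontier G).Finite) :
    ∃ S : Set (ℝ × ℝ), S.Finite ∧ (∀ p ∈ S, p.1 ≤ p.2) ∧ G = ⋃ p ∈ S, Set.Icc p.1 p.2 := by
  refine ⟨{p | p ∈ frontier G ×ˢ frontier G ∧ p.1 ≤ p.2 ∧ Set.Icc p.1 p.2 ⊆ G},
    (hf.prod hf).subset fun p hp => hp.1, fun p hp => hp.2.1, Set.Subset.antisymm ?_ ?_⟩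
  · intro x hx
    obtain ⟨M, hM⟩ := hG.bddAbove
    obtain ⟨m, hm⟩ := hG.bddBelow
    have hfr : ∀ y ∈ G, y ∈ closure Gᶜ → y ∈ frontier G := fun y hy hy' => by
      rw [frontier_eq_closure_inter_closure]; exact ⟨subset_closure hy, hy'⟩
    have hint : ∀ y, y ∉ closure Gᶜ → y ∈ G := fun y hy => by
      by_contra h; exact hy (subset_closure h)
    have hne : (Set.Ici x ∩ closure Gᶜ).Nonempty :=
      ⟨M + 1, by have := hM hx; simp only [Set.mem_Ici]; linarith,
        subset_closure fun h => by have := hM h; linarith⟩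
    have hne' : (Set.Iic x ∩ closure Gᶜ).Nonempty :=
      ⟨m - 1, by have := hm hx; simp only [Set.mem_Iic]; linarith,
        subset_closure fun h => by have := hm h; linarith⟩
    have hbb : BddBelow (Set.Ici x ∩ closure Gᶜ) := ⟨x, fun y hy => hy.1⟩
    have hba : BddAbove (Set.Iic x ∩ closure Gᶜ) := ⟨x, fun y hy => hy.1⟩
    obtain ⟨hb1, hb2⟩ := (isClosed_Ici.inter isClosed_closure).csInf_mem hne hbb
    obtain ⟨ha1, ha2⟩ := (isClosed_Iic.inter isClosed_closure).csSup_mem hne' hba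
    -- `a` and `b` are the points of the closed set `closure Gᶜ` nearest to `x` on either side.
    -- Everything between them is in `G`, and so are they because `G` is closed; hence both are
    -- frontier points, possibly both equal to `x`.
    set b := sInf (Set.Ici x ∩ closure Gᶜ) with hb
    set a := sSup (Set.Iic x ∩ closure Gᶜ) with ha
    simp only [Set.mem_Ici] at hb1
    simp only [Set.mem_Iic] at ha1
    have hr : Set.Ico x b ⊆ G := fun y hy => hint y fun h =>
      (not_lt.2 (csInf_le hbb ⟨hy.1, h⟩)) hy.2
    have hl : Set.Ioc a x ⊆ G := fun y hy => hint y fun h =>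
      (not_lt.2 (le_csSup hba ⟨hy.2, h⟩)) hy.1
    have hbG : b ∈ G := by
      rcases hb1.eq_or_lt with h | h
      · rw [← h]; exact hx
      · refine hG.isClosed.closure_subset_iff.2 hr ?_
        rw [closure_Ico h.ne]; exact Set.right_mem_Icc.2 h.le
    have haG : a ∈ G := by
      rcases ha1.eq_or_lt with h | h
      · rw [h]; exact hx
      · refine hG.isClosed.closure_subset_iff.2 hl ?_
        rw [closure_Ioc h.ne]; exact Set.left_mem_Icc.2 h.le
    simp only [Set.mem_iUnion]
    refine ⟨(a, b), ⟨⟨hfr a haG ha2, hfr b hbG hb2⟩, ha1.trans hb1, ?_⟩, ha1, hb1⟩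
    intro y hy
    rcases le_total y x with h | h
    · rcases hy.1.eq_or_lt with h' | h'
      · exact h' ▸ haG
      · exact hl ⟨h', h⟩
    · rcases hy.2.eq_or_lt with h' | h'
      · exact h' ▸ hbG
      · exact hr ⟨h, h'⟩
  · simp only [Set.iUnion_subset_iff]
    exact fun p hp => hp.2.2

/-- Pull `B` back to the parameter interval. By `hloc`, a parameter of the preimage is interior to
it unless it is an end of the interval or maps into `E`. So the preimage has finite frontier and is
a finite union of closed intervals, whose images are the arcs. -/
theorem exists_arcs_of_param {B Z E : Set Plane} {γ : ℝ → Plane} (hγ : Continuous γ) {α β : ℝ}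
    (hB : IsClosed B) (himg : B ∩ Z ⊆ γ '' Set.Icc α β) (hZ : ∀ t, γ t ∈ Z)
    (hE : {t | t ∈ Set.Icc α β ∧ γ t ∈ E}.Finite)
    (hloc : ∀ x ∉ E, x ∈ Z → x ∈ B → ∀ᶠ y in 𝓝 x, y ∈ Z → y ∈ B)
    (hseg : ∀ a b : ℝ, a ≤ b → IsArcOrSegment (γ '' Set.Icc a b)) :
    ∃ 𝒜 : Set (Set Plane), 𝒜.Finite ∧ (∀ A ∈ 𝒜, IsArcOrSegment A) ∧ ⋃₀ 𝒜 = B ∩ Z := by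
  set G := Set.Icc α β ∩ γ ⁻¹' B with hG
  have hGc : IsCompact G := isCompact_Icc.inter_right (hB.preimage hγ)
  have hfr : frontier G ⊆ {α, β} ∪ {t | t ∈ Set.Icc α β ∧ γ t ∈ E} := by
    intro t ht
    have htG : t ∈ G := hGc.isClosed.frontier_subset ht
    by_contra hne
    simp only [Set.mem_union, Set.mem_insert_iff, Set.mem_singleton_iff, not_or,
      Set.mem_ofPred_eq, not_and] at hne
    have h1 : t ∈ Set.Ioo α β :=
      ⟨lt_of_le_of_ne htG.1.1 (Ne.symm hne.1.1), lt_of_le_of_ne htG.1.2 hne.1.2⟩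
    have h2 := hγ.continuousAt.eventually (hloc _ (hne.2 htG.1) (hZ t) htG.2)
    have h3 : G ∈ 𝓝 t := by
      filter_upwards [h2, Icc_mem_nhds h1.1 h1.2] with s hs hs'
      exact ⟨hs', hs (hZ s)⟩
    exact ht.2 (mem_interior_iff_mem_nhds.2 h3)
  obtain ⟨S, hS, hle, hGS⟩ := exists_finite_Icc hGc
    (((Set.toFinite {α, β}).union hE).subset hfr)
  refine ⟨(fun p : ℝ × ℝ => γ '' Set.Icc p.1 p.2) '' S, hS.image _, ?_, ?_⟩
  · rintro _ ⟨p, hp, rfl⟩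
    exact hseg _ _ (hle p hp)
  · have : ⋃₀ ((fun p : ℝ × ℝ => γ '' Set.Icc p.1 p.2) '' S) = γ '' G := by
      rw [hGS, Set.sUnion_image, Set.image_iUnion₂]
    rw [this]
    refine Set.Subset.antisymm ?_ ?_
    · rintro _ ⟨t, ht, rfl⟩
      exact ⟨ht.2, hZ t⟩
    · rintro x hx
      obtain ⟨t, ht, rfl⟩ := himg hx
      exact ⟨t, ⟨ht, hx.1⟩, rfl⟩

theorem exists_arcs_of_finite {X : Set Plane} (hX : X.Finite) :
    ∃ 𝒜 : Set (Set Plane), 𝒜.Finite ∧ (∀ A ∈ 𝒜, IsArcOrSegment A) ∧ ⋃₀ 𝒜 = X := by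
  refine ⟨(fun x => {x}) '' X, hX.image _, ?_, ?_⟩
  · rintro _ ⟨x, -, rfl⟩
    exact Or.inr ⟨x, x, by simp⟩
  · rw [Set.sUnion_image]; simp

/-- The standard parametrization of a circle. -/
noncomputable def circleParam (c : Plane) (ρ θ : ℝ) : Plane := c + ρ • !₂[Real.cos θ, Real.sin θ]

theorem circleParam_zero (c : Plane) (ρ θ : ℝ) : circleParam c ρ θ 0 = c 0 + ρ * Real.cos θ := by
  simp [circleParam]

theorem circleParam_one (c : Plane) (ρ θ : ℝ) : circleParam c ρ θ 1 = c 1 + ρ * Real.sin θ := by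
  simp [circleParam]

theorem continuous_circleParam (c : Plane) (ρ : ℝ) : Continuous (circleParam c ρ) := by
  have h : Continuous fun θ : ℝ => (!₂[Real.cos θ, Real.sin θ] : Plane) := by
    refine (PiLp.continuous_toLp 2 _).comp ?_
    refine continuous_pi fun i => ?_
    fin_cases i
    · exact Real.continuous_cos
    · exact Real.continuous_sin
  unfold circleParam
  fun_prop

theorem plane_ext {x y : Plane} (h0 : x 0 = y 0) (h1 : x 1 = y 1) : x = y := by
  ext i; fin_cases i
  · exact h0
  · exact h1

/-- Every point of a circle has an angle in `(-π, π]`. -/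
theorem exists_circleParam {c x : Plane} {ρ : ℝ} (hρ : 0 < ρ) (h : dist x c ^ 2 = ρ ^ 2) :
    ∃ θ ∈ Set.Ioc (-Real.pi) Real.pi, circleParam c ρ θ = x := by
  rw [dist_sq_eq] at h
  set z : ℂ := ⟨x 0 - c 0, x 1 - c 1⟩ with hz
  have hn : ‖z‖ = ρ := by
    rw [← sq_eq_sq₀ (norm_nonneg _) hρ.le, Complex.sq_norm, Complex.normSq_apply, ← h]
    simp only [hz]; ring
  refine ⟨z.arg, Complex.arg_mem_Ioc z, plane_ext ?_ ?_⟩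
  · rw [circleParam_zero, ← hn, Complex.norm_mul_cos_arg]; simp [hz]
  · rw [circleParam_one, ← hn, Complex.norm_mul_sin_arg]; simp [hz]

theorem circleParam_injOn (c : Plane) {ρ : ℝ} (hρ : ρ ≠ 0) :
    Set.InjOn (circleParam c ρ) (Set.Ioc (-Real.pi) Real.pi) := by
  intro θ hθ ψ hψ h
  have h0 : circleParam c ρ θ 0 = circleParam c ρ ψ 0 := by rw [h]
  have h1 : circleParam c ρ θ 1 = circleParam c ρ ψ 1 := by rw [h]
  rw [circleParam_zero, circleParam_zero] at h0
  rw [circleParam_one, circleParam_one] at h1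
  have h0 : Real.cos θ = Real.cos ψ := mul_left_cancel₀ hρ (add_left_cancel h0)
  have h1 : Real.sin θ = Real.sin ψ := mul_left_cancel₀ hρ (add_left_cancel h1)
  have := congrArg Real.Angle.toReal (Real.Angle.cos_sin_inj h0 h1)
  rwa [Real.Angle.toReal_coe_eq_self_iff_mem_Ioc.2 hθ,
    Real.Angle.toReal_coe_eq_self_iff_mem_Ioc.2 hψ] at this

/-- A parametrized line maps intervals to segments. -/
theorem image_lineParam (p v : Plane) {a b : ℝ} (hab : a ≤ b) :
    (fun t : ℝ => p + t • v) '' Set.Icc a b = segment ℝ (p + a • v) (p + b • v) := by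
  rw [← segment_eq_Icc hab]
  have h : (fun t : ℝ => p + t • v) = (AffineMap.lineMap p (p + v) : ℝ →ᵃ[ℝ] Plane) := by
    funext t
    rw [AffineMap.lineMap_apply]
    simp [add_comm]
  have ha := congrFun h a
  have hb := congrFun h b
  rw [h, image_segment, ← ha, ← hb]

/-- The base point is the foot of the perpendicular from the origin, which makes the parameter of
`x` a linear function of `x`. -/
theorem Quad.line_of_a_eq_zero {f : Quad} (ha : f.a = 0) (hm : f.b ^ 2 + f.c ^ 2 ≠ 0) :
    ∃ p : Plane, (∀ t : ℝ, f.eval (p + t • !₂[-f.c, f.b]) = 0) ∧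
      ∀ x : Plane, f.eval x = 0 →
        x = p + ((-f.c * x 0 + f.b * x 1) / (f.b ^ 2 + f.c ^ 2)) • !₂[-f.c, f.b] := by
  set m := f.b ^ 2 + f.c ^ 2 with hmdef
  refine ⟨!₂[-f.d * f.b / m, -f.d * f.c / m], fun t => ?_, fun x hx => ?_⟩
  · simp [Quad.eval, ha]
    field_simp
    rw [hmdef]; ring
  · simp only [Quad.eval, ha] at hx
    refine plane_ext ?_ ?_
    · simp; field_simp; rw [hmdef]; linear_combination f.b * hx
    · simp; field_simp; rw [hmdef]; linear_combination f.c * hx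

theorem Quad.eval_eq_of_a_ne_zero {f : Quad} (ha : f.a ≠ 0) (x : Plane) :
    f.eval x = f.a * (dist x !₂[-f.b / (2 * f.a), -f.c / (2 * f.a)] ^ 2 -
      ((f.b ^ 2 + f.c ^ 2) / (4 * f.a ^ 2) - f.d / f.a)) := by
  rw [dist_sq_eq]
  simp [Quad.eval]
  field_simp
  ring

theorem exists_arcs_inter_zeros {B E : Set Plane} {f : Quad} (hf : f ≠ ⟨0, 0, 0, 0⟩)
    (hB : IsClosed B) (hb : Bornology.IsBounded B) (hE : E.Finite)
    (hloc : ∀ x ∉ E, f.eval x = 0 → x ∈ B → ∀ᶠ y in 𝓝 x, f.eval y = 0 → y ∈ B) :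
    ∃ 𝒜 : Set (Set Plane), 𝒜.Finite ∧ (∀ A ∈ 𝒜, IsArcOrSegment A) ∧
      ⋃₀ 𝒜 = B ∩ {x | f.eval x = 0} := by
  by_cases ha : f.a = 0
  · by_cases hm : f.b ^ 2 + f.c ^ 2 = 0
    · have hbz : f.b = 0 := by nlinarith [sq_nonneg f.b, sq_nonneg f.c]
      have hcz : f.c = 0 := by nlinarith [sq_nonneg f.b, sq_nonneg f.c]
      have hd : f.d ≠ 0 := fun hd => hf (by ext <;> assumption)
      apply exists_arcs_of_finite
      convert Set.finite_empty using 1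
      ext x
      simp [Quad.eval, ha, hbz, hcz, hd]
    · obtain ⟨p, hp1, hp2⟩ := Quad.line_of_a_eq_zero ha hm
      set v : Plane := !₂[-f.c, f.b] with hv
      have hv0 : v ≠ 0 := by
        intro h0
        have h1 : v 0 = 0 := by rw [h0]; rfl
        have h2 : v 1 = 0 := by rw [h0]; rfl
        simp [hv] at h1 h2
        exact hm (by rw [h1, h2]; ring)
      set τ : Plane → ℝ := fun x => (-f.c * x 0 + f.b * x 1) / (f.b ^ 2 + f.c ^ 2) with hτ
      have hτc : Continuous τ := by rw [hτ]; fun_prop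
      have hcpt : IsCompact (τ '' B) := (Metric.isCompact_of_isClosed_isBounded hB hb).image hτc
      obtain ⟨M, hM⟩ := hcpt.bddAbove
      obtain ⟨m, hm'⟩ := hcpt.bddBelow
      refine exists_arcs_of_param (E := E) (γ := fun t : ℝ => p + t • v) (α := m) (β := M)
        (by fun_prop) hB ?_ hp1 ?_ hloc ?_
      · rintro x ⟨hx, hx0⟩
        exact ⟨τ x, ⟨hm' ⟨x, hx, rfl⟩, hM ⟨x, hx, rfl⟩⟩, (hp2 x hx0).symm⟩
      · refine (hE.preimage (f := fun t : ℝ => p + t • v) ?_).subset fun t ht => ht.2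
        intro s _ t _ hst
        exact smul_left_injective ℝ hv0 (add_left_cancel hst)
      · intro a b hab
        exact Or.inr ⟨_, _, image_lineParam p v hab⟩
  · have hev := Quad.eval_eq_of_a_ne_zero ha
    set c : Plane := !₂[-f.b / (2 * f.a), -f.c / (2 * f.a)] with hc
    set k := (f.b ^ 2 + f.c ^ 2) / (4 * f.a ^ 2) - f.d / f.a with hk
    have hz : ∀ x, f.eval x = 0 ↔ dist x c ^ 2 = k := fun x => by
      rw [hev, mul_eq_zero, or_iff_right ha, sub_eq_zero]
    rcases le_or_gt k 0 with h | h
    · apply exists_arcs_of_finite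
      refine (Set.finite_singleton c).subset ?_
      rintro x ⟨-, hx⟩
      have hx := (hz x).1 hx
      have : dist x c = 0 := by
        have := sq_nonneg (dist x c)
        exact pow_eq_zero_iff (two_ne_zero) |>.1 (by linarith)
      exact dist_eq_zero.1 this
    · have hρ : 0 < √k := Real.sqrt_pos.2 h
      have hsq : √k ^ 2 = k := Real.sq_sqrt h.le
      refine exists_arcs_of_param (E := E) (γ := circleParam c √k) (α := -Real.pi) (β := Real.pi)
        (continuous_circleParam _ _) hB ?_ ?_ ?_ hloc ?_
      · rintro x ⟨-, hx⟩
        obtain ⟨θ, hθ, rfl⟩ := exists_circleParam hρ (by rw [hsq]; exact (hz x).1 hx)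
        exact ⟨θ, Set.Ioc_subset_Icc_self hθ, rfl⟩
      · intro t
        show f.eval _ = 0
        rw [hz, dist_sq_eq, circleParam_zero, circleParam_one]
        linear_combination k * Real.sin_sq_add_cos_sq t + hsq * (Real.sin t ^ 2 + Real.cos t ^ 2)
      -- The circle parametrization is injective only on the half-open interval, so `-π` is added as
      -- one extra parameter.
      · have : ({t | t ∈ Set.Ioc (-Real.pi) Real.pi ∧ circleParam c √k t ∈ E}).Finite := by
          refine Set.Finite.of_finite_image (f := circleParam c √k) (hE.subset ?_) ?_
          · rintro _ ⟨t, ht, rfl⟩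
            exact ht.2
          · exact (circleParam_injOn c hρ.ne').mono fun t ht => ht.1
        refine (this.union (Set.finite_singleton (-Real.pi))).subset ?_
        rintro t ⟨ht, ht'⟩
        rcases ht.1.eq_or_lt with h | h
        · exact Or.inr h.symm
        · exact Or.inl ⟨⟨h, ht.2⟩, ht'⟩
      · intro a b hab
        exact Or.inl ⟨c, √k, a, b, hρ, hab, rfl⟩

/-- A bounded tame set is bounded by finitely many arcs and segments. -/
theorem TameSet.boundedByArcs {Q : Set Plane} (h : TameSet Q) (hb : Bornology.IsBounded Q) :
    BoundedByArcs Q := by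
  obtain ⟨F, E, hF, hE, hfr, -, hloc, -⟩ := h.frontier_structure
  have hbf : Bornology.IsBounded (frontier Q) := hb.closure.subset frontier_subset_closure
  -- Stated for every `f`, with the empty family outside the relevant ones, so that families can be
  -- chosen as a function of `f`.
  have key : ∀ f : Quad, ∃ 𝒜 : Set (Set Plane), 𝒜.Finite ∧ (∀ A ∈ 𝒜, IsArcOrSegment A) ∧
      (f ∈ F → f ≠ ⟨0, 0, 0, 0⟩ → ⋃₀ 𝒜 = frontier Q ∩ {x | f.eval x = 0}) ∧
      ⋃₀ 𝒜 ⊆ frontier Q := by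
    intro f
    by_cases hf : f ∈ F ∧ f ≠ ⟨0, 0, 0, 0⟩
    · obtain ⟨𝒜, h1, h2, h3⟩ := exists_arcs_inter_zeros hf.2 isClosed_frontier hbf hE
        (hloc f hf.1 hf.2)
      exact ⟨𝒜, h1, h2, fun _ _ => h3, h3 ▸ Set.inter_subset_left⟩
    · exact ⟨∅, Set.finite_empty, by simp, fun h1 h2 => absurd ⟨h1, h2⟩ hf, by simp⟩
  choose 𝒜 h1 h2 h3 h4 using key
  refine ⟨⋃ f ∈ F, 𝒜 f, hF.biUnion fun f _ => h1 f, ?_, ?_⟩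
  · intro A hA
    simp only [Set.mem_iUnion] at hA
    obtain ⟨f, -, hA⟩ := hA
    exact h2 f A hA
  · refine Set.Subset.antisymm ?_ ?_
    · intro x hx
      obtain ⟨f, hf, hf0, hfx⟩ := hfr x hx
      have : x ∈ ⋃₀ 𝒜 f := by rw [h3 f hf hf0]; exact ⟨hx, hfx⟩
      obtain ⟨A, hA, hxA⟩ := this
      exact ⟨A, Set.mem_biUnion hf hA, hxA⟩
    · rintro x ⟨A, hA, hxA⟩
      simp only [Set.mem_iUnion] at hA
      obtain ⟨f, -, hA⟩ := hA
      exact h4 f ⟨A, hA, hxA⟩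

/-! ### Elimination of one linear variable -/

/-- The signs of the coefficients and of the `2 × 2` determinants of a finite family of functions
`a + t b` determine which sign vectors the family attains. -/
theorem exists_sign_eq {ι : Type*} [Finite ι] {a b a' b' : ι → ℝ}
    (ha : ∀ i, SignType.sign (a i) = SignType.sign (a' i))
    (hb : ∀ i, SignType.sign (b i) = SignType.sign (b' i))
    (hab : ∀ i j, SignType.sign (a i * b j - a j * b i) =
      SignType.sign (a' i * b' j - a' j * b' i)) (t : ℝ) :
    ∃ t', ∀ i, SignType.sign (a i + t * b i) = SignType.sign (a' i + t' * b' i) := by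
  classical
  have := Fintype.ofFinite ι
  have hb0 : ∀ i, b i = 0 ↔ b' i = 0 := fun i => by
    rw [← sign_eq_zero_iff, hb, sign_eq_zero_iff]
  -- If `t` is a root of some nonconstant member, the same member's root serves as `t'`. All other
  -- values at that root are determinants divided by the slope.
  by_cases h : ∃ j, b j ≠ 0 ∧ a j + t * b j = 0
  · obtain ⟨j, hj, hj0⟩ := h
    have hj' : b' j ≠ 0 := fun h => hj ((hb0 j).2 h)
    refine ⟨-a' j / b' j, fun i => ?_⟩
    have e1 : a i + t * b i = (a i * b j - a j * b i) * (b j)⁻¹ := by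
      field_simp; linear_combination b i * hj0
    have e2 : a' i + -a' j / b' j * b' i = (a' i * b' j - a' j * b' i) * (b' j)⁻¹ := by
      field_simp; ring
    have hinv : ∀ u : ℝ, SignType.sign u⁻¹ = SignType.sign u := fun u => by
      rcases lt_trichotomy u 0 with h | h | h
      · rw [sign_neg h, sign_neg (inv_lt_zero.2 h)]
      · simp [h]
      · rw [sign_pos h, sign_pos (inv_pos.2 h)]
    rw [e1, e2, sign_mul, sign_mul, hab, hinv, hinv, hb]
  · push Not at h
    -- The determinants and slopes fix the order of the roots. A `t` that is no root can therefore
    -- be matched by a `t'` strictly between the images of the roots below and above it.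
    have hroot : ∀ i j, b i ≠ 0 → b j ≠ 0 → -a i / b i < -a j / b j → -a' i / b' i < -a' j / b' j := by
      intro i j hi hj hlt
      have hi' : b' i ≠ 0 := fun h => hi ((hb0 i).2 h)
      have hj' : b' j ≠ 0 := fun h => hj ((hb0 j).2 h)
      have e1 : (-a j / b j - -a i / b i) * (b i * b i * (b j * b j)) =
          (a i * b j - a j * b i) * (b i * b j) := by field_simp; ring
      have e2 : (-a' j / b' j - -a' i / b' i) * (b' i * b' i * (b' j * b' j)) =
          (a' i * b' j - a' j * b' i) * (b' i * b' j) := by field_simp; ring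
      have h1 : 0 < (a i * b j - a j * b i) * (b i * b j) := by
        rw [← e1]
        exact mul_pos (sub_pos.2 hlt) (mul_pos (mul_self_pos.2 hi) (mul_self_pos.2 hj))
      rw [← sign_eq_one_iff, sign_mul, sign_mul, hab, hb, hb, ← sign_mul, ← sign_mul,
        sign_eq_one_iff, ← e2] at h1
      exact sub_pos.1 (pos_of_mul_pos_left h1
        (mul_nonneg (mul_self_nonneg _) (mul_self_nonneg _)))
    set lo : Finset ℝ := (Finset.univ.filter fun i => b i ≠ 0 ∧ -a i / b i < t).image
      fun i => -a' i / b' i with hlo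
    set hi : Finset ℝ := (Finset.univ.filter fun i => b i ≠ 0 ∧ t < -a i / b i).image
      fun i => -a' i / b' i with hhi
    obtain ⟨t', h1, h2⟩ := Order.exists_between_finsets lo hi (by
      intro u hu v hv
      simp only [hlo, hhi, Finset.mem_image, Finset.mem_filter, Finset.mem_univ, true_and] at hu hv
      obtain ⟨i, ⟨hi, hi'⟩, rfl⟩ := hu
      obtain ⟨j, ⟨hj, hj'⟩, rfl⟩ := hv
      exact hroot i j hi hj (hi'.trans hj'))
    refine ⟨t', fun i => ?_⟩
    by_cases hi0 : b i = 0
    · rw [hi0, (hb0 i).1 hi0, mul_zero, mul_zero, add_zero, add_zero, ha]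
    have hi' : b' i ≠ 0 := fun h => hi0 ((hb0 i).2 h)
    have e1 : a i + t * b i = (t - -a i / b i) * b i := by field_simp; ring
    have e2 : a' i + t' * b' i = (t' - -a' i / b' i) * b' i := by field_simp; ring
    rw [e1, e2, sign_mul, sign_mul, hb]
    congr 1
    have hne : -a i / b i ≠ t := fun he => h i hi0 (by rw [e1, he]; ring)
    rcases hne.lt_or_gt with hlt | hlt
    · have := h1 (-a' i / b' i) (Finset.mem_image_of_mem _ (by simp [hi0, hlt]))
      rw [sign_pos (by linarith), sign_pos (by linarith)]
    · have := h2 (-a' i / b' i) (Finset.mem_image_of_mem _ (by simp [hi0, hlt]))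
      rw [sign_neg (by linarith), sign_neg (by linarith)]

/-! ### Visibility of foot points -/

/-- A set described by the signs of finitely many affine functions. -/
def LinTame (P : Set Plane) : Prop :=
  ∃ H : Set (Plane → ℝ), H.Finite ∧ (∀ h ∈ H, IsAff h) ∧ ∀ x y : Plane,
    (∀ h ∈ H, SignType.sign (h x) = SignType.sign (h y)) → x ∈ P → y ∈ P

theorem LinTame.biUnion {ι : Type*} {s : Set ι} (hs : s.Finite) {U : ι → Set Plane}
    (h : ∀ i ∈ s, LinTame (U i)) : LinTame (⋃ i ∈ s, U i) := by
  choose! H h1 h2 h3 using h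
  refine ⟨⋃ i ∈ s, H i, hs.biUnion h1, ?_, ?_⟩
  · intro k hk
    simp only [Set.mem_iUnion] at hk
    obtain ⟨i, hi, hk⟩ := hk
    exact h2 i hi k hk
  · intro x y hxy hx
    simp only [Set.mem_iUnion] at hx ⊢
    obtain ⟨i, hi, hx⟩ := hx
    exact ⟨i, hi, h3 i hi x y (fun k hk => hxy k (Set.mem_biUnion hi hk)) hx⟩

theorem LinTame.tameSet {P : Set Plane} (hP : LinTame P) : TameSet P := by
  obtain ⟨H, hH, ha, hPH⟩ := hP
  have := hH.to_subtype
  obtain ⟨F, hF, hFH⟩ := Tame.pi fun h : H => (ha h.1 h.2).tame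
  refine ⟨F, hF, fun x y hxy => ?_⟩
  have e := hFH x y hxy
  exact propext ⟨hPH x y fun h hh => congrFun e ⟨h, hh⟩,
    hPH y x fun h hh => (congrFun e ⟨h, hh⟩).symm⟩

theorem IsAff.combo {h : Plane → ℝ} (hh : IsAff h) (x y : Plane) (t : ℝ) :
    h (x + t • (y - x)) = h x + t * (h y - h x) := by
  obtain ⟨b, c, d, H⟩ := hh
  simp only [H, PiLp.add_apply, PiLp.smul_apply, PiLp.sub_apply, smul_eq_mul]
  ring

theorem IsAff.exists_quad {h : Plane → ℝ} (hh : IsAff h) : ∃ f : Quad, ∀ x, f.eval x = h x := by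
  obtain ⟨b, c, d, H⟩ := hh
  exact ⟨⟨0, b, c, d⟩, fun x => by simp [Quad.eval, H]⟩

/-- A map of the plane for which visibility of `π x` from `x` can be expressed by signs. -/
structure TameFoot (π : Plane → Plane) : Prop where
  sign_eval : ∀ g : Quad, Tame fun x => SignType.sign (g.eval (π x))
  sign_sub : ∀ h, IsAff h → Tame fun x => SignType.sign (h (π x) - h x)
  sign_det : ∀ h k, IsAff h → IsAff k →
    Tame fun x => SignType.sign (h x * k (π x) - k x * h (π x))

namespace TameFoot

variable {π : Plane → Plane}

theorem sign_aff (hπ : TameFoot π) {h : Plane → ℝ} (hh : IsAff h) :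
    Tame fun x => SignType.sign (h (π x)) := by
  obtain ⟨f, hf⟩ := hh.exists_quad
  simpa [hf] using hπ.sign_eval f

theorem preimage (hπ : TameFoot π) {Q : Set Plane} (hQ : TameSet Q) : TameSet {x | π x ∈ Q} := by
  obtain ⟨F, hF, hFQ⟩ := hQ
  have := hF.to_subtype
  obtain ⟨F', hF', h'⟩ := Tame.pi fun f : F => hπ.sign_eval f.1
  exact ⟨F', hF', fun x y hxy => hFQ _ _ fun f hf => congrFun (h' x y hxy) ⟨f, hf⟩⟩

theorem neg {h : Plane → ℝ} (hh : Tame fun x => SignType.sign (h x)) :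
    Tame fun x => SignType.sign (-h x) := by
  simpa using (Tame.sign_const (-1)).mul hh

/-- On the segment each affine function reads `h x + t (h (π x) - h x)`. The segment lies in `P` if
and only if no forbidden sign vector occurs for `0 ≤ t ≤ 1`. `exists_sign_eq` eliminates `t`; the
determinants it needs are those in `sign_det`. -/
theorem visible (hπ : TameFoot π) {P : Set Plane} (hP : LinTame P) :
    TameSet {x | segment ℝ x (π x) ⊆ P} := by
  obtain ⟨H, hH, ha, hPH⟩ := hP
  have := hH.to_subtype
  -- The two `Bool` indices encode the bounds on the parameter: `true` stands for `t` and `false`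
  -- for `t - 1`.
  let A : H ⊕ Bool → Plane → ℝ := fun i x =>
    i.elim (fun h => h.1 x) (fun s => if s then 0 else -1)
  let B : H ⊕ Bool → Plane → ℝ := fun i x => i.elim (fun h => h.1 (π x) - h.1 x) (fun _ => 1)
  have hA : ∀ i, Tame fun x => SignType.sign (A i x) := by
    rintro (h | s)
    · exact (ha h.1 h.2).tame
    · exact Tame.sign_const _
  have hB : ∀ i, Tame fun x => SignType.sign (B i x) := by
    rintro (h | s)
    · exact hπ.sign_sub _ (ha h.1 h.2)
    · exact Tame.sign_const _
  have hAB : ∀ i : (H ⊕ Bool) × (H ⊕ Bool),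
      Tame fun x => SignType.sign (A i.1 x * B i.2 x - A i.2 x * B i.1 x) := by
    rintro ⟨h | s, k | s'⟩
    · have := hπ.sign_det _ _ (ha h.1 h.2) (ha k.1 k.2)
      refine (congrArg Tame (funext fun x => congrArg _ ?_)).mp this
      simp only [A, B, Sum.elim_inl]; ring
    · cases s'
      · have := hπ.sign_aff (ha h.1 h.2)
        refine (congrArg Tame (funext fun x => congrArg _ ?_)).mp this
        simp [A, B]
      · have := (ha h.1 h.2).tame
        refine (congrArg Tame (funext fun x => congrArg _ ?_)).mp this
        simp [A, B]
    · cases s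
      · have := neg (hπ.sign_aff (ha k.1 k.2))
        refine (congrArg Tame (funext fun x => congrArg _ ?_)).mp this
        simp [A, B]
      · have := neg (ha k.1 k.2).tame
        refine (congrArg Tame (funext fun x => congrArg _ ?_)).mp this
        simp [A, B]
    · exact Tame.sign_const ((if s then 0 else -1) * 1 - (if s' then 0 else -1) * 1)
  obtain ⟨F, hF, hFH⟩ := ((Tame.pi hA).comp₂ (Tame.pi hB) Prod.mk).comp₂ (Tame.pi hAB) Prod.mk
  have key : ∀ x y : Plane, (∀ f ∈ F, SignType.sign (f.eval x) = SignType.sign (f.eval y)) →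
      segment ℝ y (π y) ⊆ P → segment ℝ x (π x) ⊆ P := by
    intro x y hxy hy z hz
    have e := hFH x y hxy
    simp only [Prod.mk.injEq] at e
    rw [segment_eq_image'] at hz
    obtain ⟨t, ht, rfl⟩ := hz
    obtain ⟨t', ht'⟩ := exists_sign_eq (congrFun e.1.1) (congrFun e.1.2)
      (fun i j => congrFun e.2 (i, j)) t
    have h0 := ht' (Sum.inr true)
    have h1 := ht' (Sum.inr false)
    simp only [A, B, Sum.elim_inr, if_true, mul_one, zero_add, Bool.false_eq_true, if_false] at h0 h1
    have ht0 : 0 ≤ t' := by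
      by_contra h
      rw [sign_neg (not_le.1 h), sign_eq_neg_one_iff] at h0
      linarith [ht.1]
    have ht1 : t' ≤ 1 := by
      by_contra h
      rw [sign_pos (by linarith : 0 < -1 + t'), sign_eq_one_iff] at h1
      linarith [ht.2]
    refine hPH (y + t' • (π y - y)) _ ?_ (hy ?_)
    · intro h hh
      rw [(ha h hh).combo, (ha h hh).combo]
      exact (ht' (Sum.inl ⟨h, hh⟩)).symm
    · rw [segment_eq_image']
      exact ⟨t', ⟨ht0, ht1⟩, rfl⟩
  exact ⟨F, hF, fun x y hxy => propext
    ⟨key y x fun f hf => (hxy f hf).symm, key x y hxy⟩⟩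

/-- Constant maps. -/
theorem const (w : Plane) : TameFoot fun _ => w where
  sign_eval g := Tame.const _
  sign_sub h hh := ((IsAff.const (h w)).sub hh).tame
  sign_det h k hh hk := by
    have := ((hh.const_mul (k w)).sub (hk.const_mul (h w))).tame
    refine (congrArg Tame (funext fun x => congrArg _ ?_)).mp this
    ring

end TameFoot

/-- The orthogonal projection to the line `b x₀ + c x₁ + d = 0`. -/
noncomputable def lineFoot (b c d : ℝ) (x : Plane) : Plane :=
  x - ((b * x 0 + c * x 1 + d) / (b ^ 2 + c ^ 2)) • !₂[b, c]

/-- The radial projection to the circle with centre `c` and radius `ρ`. -/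
noncomputable def circleFoot (c : Plane) (ρ : ℝ) (x : Plane) : Plane :=
  c + (ρ / dist x c) • (x - c)

theorem lineFoot_apply (b c d : ℝ) (x : Plane) :
    lineFoot b c d x 0 = x 0 - (b * x 0 + c * x 1 + d) / (b ^ 2 + c ^ 2) * b ∧
    lineFoot b c d x 1 = x 1 - (b * x 0 + c * x 1 + d) / (b ^ 2 + c ^ 2) * c := by
  constructor <;> simp [lineFoot]

theorem circleFoot_apply (c : Plane) (ρ : ℝ) (x : Plane) (i : Fin 2) :
    circleFoot c ρ x i = c i + ρ / dist x c * (x i - c i) := by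
  simp [circleFoot]

/-- On the line, `g` is a quadratic polynomial in the tangential coordinate. The displacement `π x -
x` is the defining affine function times a fixed vector, so the difference and the determinant are
products of affine functions. -/
theorem TameFoot.line {b c : ℝ} (d : ℝ) (hm : b ^ 2 + c ^ 2 ≠ 0) : TameFoot (lineFoot b c d) where
  sign_eval g := by
    set m := b ^ 2 + c ^ 2 with hmd
    have hτ : IsAff fun x => -c * x 0 + b * x 1 :=
      ((IsAff.coord 0).const_mul (-c)).add ((IsAff.coord 1).const_mul b)
    -- Taking the second affine function to be `1` turns the binary form into a polynomial in one
    -- variable.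
    have := Tame.quadForm hτ (IsAff.const 1) (g.a / m) ((b * g.c - c * g.b) / m)
      (g.a * d ^ 2 / m - (g.b * b + g.c * c) * d / m + g.d)
    refine (congrArg Tame (funext fun x => congrArg _ ?_)).mp this
    simp only [Quad.eval, lineFoot_apply, ← hmd]
    field_simp
    rw [hmd]; ring
  sign_sub h hh := by
    obtain ⟨b', c', d', H⟩ := hh
    have : IsAff fun x => -(b' * b + c' * c) / (b ^ 2 + c ^ 2) * (b * x 0 + c * x 1 + d) :=
      IsAff.const_mul _ ⟨b, c, d, fun _ => rfl⟩
    refine (congrArg Tame (funext fun x => congrArg _ ?_)).mp this.tame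
    simp only [H, lineFoot_apply]
    ring
  sign_det h k hh hk := by
    have hf : IsAff fun x => b * x 0 + c * x 1 + d := ⟨b, c, d, fun _ => rfl⟩
    obtain ⟨b', c', d', H⟩ := id hh
    obtain ⟨b'', c'', d'', K⟩ := id hk
    have := hf.tame.mul ((hk.const_mul ((b' * b + c' * c) / (b ^ 2 + c ^ 2))).sub
      (hh.const_mul ((b'' * b + c'' * c) / (b ^ 2 + c ^ 2)))).tame
    refine (congrArg Tame (funext fun x => congrArg _ ?_)).mp this
    simp only [H, K, lineFoot_apply]
    ring

theorem dist_sub_sign_tame (c : Plane) (s : ℝ) : Tame fun x => SignType.sign (dist x c - s) := by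
  rcases lt_or_ge s 0 with h | h
  · refine (congrArg Tame (funext fun x => ?_)).mp (Tame.sign_const 1)
    rw [sign_pos one_pos, sign_pos (by linarith [dist_nonneg (x := x) (y := c)])]
  · have := Tame.sign_eval (Quad.circle c (s ^ 2))
    refine (congrArg Tame (funext fun x => ?_)).mp this
    rw [Quad.eval_circle]
    rcases lt_trichotomy (dist x c) s with h' | h' | h'
    · rw [sign_neg (by linarith : dist x c - s < 0), sign_neg]
      have := (sq_lt_sq₀ dist_nonneg h).2 h'
      linarith
    · simp [h']
    · rw [sign_pos (by linarith : 0 < dist x c - s), sign_pos]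
      have := (sq_lt_sq₀ h dist_nonneg).2 h'
      linarith

/-- Multiply by `N = dist x c`. On the circle `‖y - c‖` is constant, so `N g(π x)` is a cone
function with apex `c`; the difference and the determinant both acquire the factor `ρ - N` beside an
affine one. The centre, where `N = 0`, is a harmless exceptional point. -/
theorem TameFoot.circle (c : Plane) (ρ : ℝ) : TameFoot (circleFoot c ρ) where
  sign_eval g := by
    have := Tame.cone c (g.a * (c 0 ^ 2 + c 1 ^ 2 + ρ ^ 2) + g.b * c 0 + g.c * c 1 + g.d)
      (ρ * (2 * g.a * c 0 + g.b)) (ρ * (2 * g.a * c 1 + g.c))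
    refine this.congr_off_finite (Set.finite_singleton c) fun x hx => ?_
    have hN : 0 < dist x c := dist_pos.2 hx
    have hsq := dist_sq_eq x c
    rw [← one_mul (SignType.sign (g.eval _)), ← sign_pos hN, ← sign_mul]
    congr 1
    simp only [Quad.eval, circleFoot_apply]
    field_simp
    linear_combination (-g.a * ρ ^ 2) * hsq
  sign_sub h hh := by
    obtain ⟨b', c', d', H⟩ := hh
    have hl : IsAff fun x => b' * (x 0 - c 0) + c' * (x 1 - c 1) :=
      (((IsAff.coord 0).sub (IsAff.const _)).const_mul b').add
        (((IsAff.coord 1).sub (IsAff.const _)).const_mul c')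
    refine ((TameFoot.neg (dist_sub_sign_tame c ρ)).mul hl.tame).congr_off_finite
      (Set.finite_singleton c) fun x hx => ?_
    have hN : 0 < dist x c := dist_pos.2 hx
    rw [← one_mul (SignType.sign (h _ - h x)), ← sign_pos hN, ← sign_mul]
    congr 1
    simp only [H, circleFoot_apply]
    field_simp
    ring
  sign_det h k hh hk := by
    obtain ⟨b', c', d', H⟩ := id hh
    obtain ⟨b'', c'', d'', K⟩ := id hk
    have hl := ((hk.sub (IsAff.const (k c))).const_mul (h c)).sub
      ((hh.sub (IsAff.const (h c))).const_mul (k c))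
    refine ((TameFoot.neg (dist_sub_sign_tame c ρ)).mul hl.tame).congr_off_finite
      (Set.finite_singleton c) fun x hx => ?_
    have hN : 0 < dist x c := dist_pos.2 hx
    rw [← one_mul (SignType.sign (h x * k _ - _)), ← sign_pos hN, ← sign_mul]
    congr 1
    simp only [H, K, circleFoot_apply]
    field_simp
    ring

/-! ### Nearest points on lines and circles -/

/-- The derivative of the squared distance along the line vanishes at `q`, so `x - q` is normal to
the line. -/
theorem lineFoot_eq_of_localMin {b c d : ℝ} (hm : b ^ 2 + c ^ 2 ≠ 0) {x q : Plane}
    (hq : b * q 0 + c * q 1 + d = 0)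
    (hmin : ∀ᶠ y : Plane in 𝓝 q, b * y 0 + c * y 1 + d = 0 → dist x q ≤ dist x y) :
    lineFoot b c d x = q := by
  set γ : ℝ → Plane := fun s => q + s • !₂[-c, b] with hγ
  have hγ0 : ∀ s, γ s 0 = q 0 - s * c := fun s => by simp [hγ]; ring
  have hγ1 : ∀ s, γ s 1 = q 1 + s * b := fun s => by simp [hγ]
  have hγc : Tendsto γ (𝓝 0) (𝓝 q) := by
    have : Continuous γ := by fun_prop
    simpa [hγ] using this.tendsto 0
  set φ : ℝ → ℝ := fun s => (x 0 - (q 0 - s * c)) ^ 2 + (x 1 - (q 1 + s * b)) ^ 2 with hφ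
  have hloc : IsLocalMin φ 0 := by
    filter_upwards [hγc.eventually hmin] with s hs
    have h1 := hs (by rw [hγ0, hγ1]; linear_combination hq)
    have h2 := pow_le_pow_left₀ dist_nonneg h1 2
    rw [dist_sq_eq, dist_sq_eq, hγ0, hγ1] at h2
    simpa [hφ] using h2
  have hder : HasDerivAt φ (2 * (x 0 - q 0) * c - 2 * (x 1 - q 1) * b) 0 := by
    have e1 : HasDerivAt (fun s : ℝ => x 0 - (q 0 - s * c)) c 0 := by
      have := (((hasDerivAt_id (0 : ℝ)).mul_const c).const_sub (q 0)).const_sub (x 0)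
      simpa using this
    have e2 : HasDerivAt (fun s : ℝ => x 1 - (q 1 + s * b)) (-b) 0 := by
      have := (((hasDerivAt_id (0 : ℝ)).mul_const b).const_add (q 1)).const_sub (x 1)
      simpa using this
    refine ((e1.pow 2).add (e2.pow 2)).congr_deriv ?_
    norm_num; ring
  have h0 := hloc.hasDerivAt_eq_zero hder
  have hx := lineFoot_apply b c d x
  refine plane_ext ?_ ?_
  · rw [hx.1]
    field_simp
    linear_combination (c / 2) * h0 - b * hq
  · rw [hx.2]
    field_simp
    linear_combination (-b / 2) * h0 - c * hq

/-- The first-order condition makes `x - c` a multiple `l` of the unit vector towards `q`;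
minimality then excludes `l < 0`. -/
theorem circleFoot_eq_of_localMin {c x q : Plane} {ρ : ℝ} (hρ : 0 < ρ) (hx : x ≠ c)
    (hq : dist q c ^ 2 = ρ ^ 2)
    (hmin : ∀ᶠ y in 𝓝 q, dist y c ^ 2 = ρ ^ 2 → dist x q ≤ dist x y) :
    circleFoot c ρ x = q := by
  obtain ⟨θ₀, -, rfl⟩ := exists_circleParam hρ hq
  set v0 := x 0 - c 0 with hv0
  set v1 := x 1 - c 1 with hv1
  set φ : ℝ → ℝ := fun θ => v0 * Real.cos θ + v1 * Real.sin θ with hφ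
  have hdist : ∀ θ, dist x (circleParam c ρ θ) ^ 2 = v0 ^ 2 + v1 ^ 2 + ρ ^ 2 - 2 * ρ * φ θ := by
    intro θ
    rw [dist_sq_eq, circleParam_zero, circleParam_one]
    simp only [hφ, hv0, hv1]
    linear_combination ρ ^ 2 * Real.sin_sq_add_cos_sq θ
  have hloc : IsLocalMax φ θ₀ := by
    filter_upwards [(continuous_circleParam c ρ).continuousAt.eventually hmin] with θ hθ
    have h1 := hθ (by
      rw [dist_sq_eq, circleParam_zero, circleParam_one]
      linear_combination ρ ^ 2 * Real.sin_sq_add_cos_sq θ)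
    have h2 := pow_le_pow_left₀ dist_nonneg h1 2
    rw [hdist, hdist] at h2
    exact le_of_mul_le_mul_left (by linarith) (by positivity : 0 < 2 * ρ)
  have hder : HasDerivAt φ (v0 * -Real.sin θ₀ + v1 * Real.cos θ₀) θ₀ :=
    ((Real.hasDerivAt_cos θ₀).const_mul v0).add ((Real.hasDerivAt_sin θ₀).const_mul v1)
  have h0 := hloc.hasDerivAt_eq_zero hder
  set l := φ θ₀ with hl
  have hsc := Real.sin_sq_add_cos_sq θ₀
  have e0 : v0 = l * Real.cos θ₀ := by
    rw [hl, hφ]; linear_combination (-v0) * hsc - Real.sin θ₀ * h0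
  have e1 : v1 = l * Real.sin θ₀ := by
    rw [hl, hφ]; linear_combination (-v1) * hsc + Real.cos θ₀ * h0
  have hNl : dist x c ^ 2 = l ^ 2 := by
    rw [dist_sq_eq, ← hv0, ← hv1, e0, e1]; linear_combination l ^ 2 * hsc
  have hN : 0 < dist x c := dist_pos.2 hx
  -- The derivative also vanishes at the farthest point of the circle. If `l < 0`, turning by a
  -- small angle `s` gives `φ = l cos s > l`, against the local maximum.
  have hlpos : 0 ≤ l := by
    by_contra hneg
    push Not at hneg
    obtain ⟨ε, hε, hball⟩ := Metric.eventually_nhds_iff.1 hloc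
    set s := min (ε / 2) Real.pi with hs
    have hs0 : 0 < s := lt_min (by linarith) Real.pi_pos
    have hsε : s < ε := (min_le_left _ _).trans_lt (by linarith)
    have h3 := hball (y := θ₀ + s) (by simpa [Real.dist_eq, abs_of_pos hs0] using hsε)
    have h4 : φ (θ₀ + s) = l * Real.cos s := by
      simp only [hφ, Real.cos_add, Real.sin_add]
      rw [e0, e1]
      linear_combination l * Real.cos s * hsc
    rw [h4] at h3
    have h5 : Real.cos s < Real.cos 0 :=
      Real.cos_lt_cos_of_nonneg_of_le_pi le_rfl (min_le_right _ _) hs0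
    rw [Real.cos_zero] at h5
    nlinarith
  have hNeq : dist x c = l := (sq_eq_sq₀ hN.le hlpos).1 hNl
  refine plane_ext ?_ ?_
  · rw [circleFoot_apply, circleParam_zero, ← hv0, e0, hNeq]
    field_simp [hNeq ▸ hN.ne']
  · rw [circleFoot_apply, circleParam_one, ← hv1, e1, hNeq]
    field_simp [hNeq ▸ hN.ne']

theorem lineFoot_dist_tame {b c : ℝ} (d : ℝ) (hm : b ^ 2 + c ^ 2 ≠ 0) (δ : ℝ) :
    TameSet {x | dist x (lineFoot b c d x) < δ} := by
  have hpos : 0 < b ^ 2 + c ^ 2 := lt_of_le_of_ne (by positivity) (Ne.symm hm)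
  rcases le_or_gt δ 0 with h | h
  · convert TameSet.empty using 1
    ext x
    simp only [Set.mem_ofPred_eq, Set.mem_empty_iff_false, iff_false, not_lt]
    exact h.trans dist_nonneg
  · have hf : IsAff fun x => b * x 0 + c * x 1 + d := ⟨b, c, d, fun _ => rfl⟩
    have := TameSet.pos (Tame.quadForm hf (IsAff.const 1) (-1) 0 (δ ^ 2 * (b ^ 2 + c ^ 2)))
    convert this using 1
    ext x
    have hl := lineFoot_apply b c d x
    simp only [Set.mem_ofPred_eq]
    rw [← sq_lt_sq₀ dist_nonneg h.le, dist_sq_eq, hl.1, hl.2]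
    have e : (x 0 - (x 0 - (b * x 0 + c * x 1 + d) / (b ^ 2 + c ^ 2) * b)) ^ 2 +
        (x 1 - (x 1 - (b * x 0 + c * x 1 + d) / (b ^ 2 + c ^ 2) * c)) ^ 2 =
        (b * x 0 + c * x 1 + d) ^ 2 / (b ^ 2 + c ^ 2) := by
      field_simp; ring
    rw [e, div_lt_iff₀ hpos]
    constructor <;> intro h' <;> linarith

/-- Away from the centre the distance to the foot is `|dist x c - ρ|`, so the condition describes an
annulus. -/
theorem circleFoot_dist_tame (c : Plane) (ρ δ : ℝ) :
    TameSet {x | dist x (circleFoot c ρ x) < δ} := by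
  have := (dist_sub_sign_tame c (ρ - δ)).comp₂ (dist_sub_sign_tame c (ρ + δ))
    (fun s t => s = 1 ∧ t = -1)
  refine this.congr_off_finite (Set.finite_singleton c) fun x hx => propext ?_
  have hN : 0 < dist x c := dist_pos.2 hx
  have e : dist x (circleFoot c ρ x) = |dist x c - ρ| := by
    have h1 : x - circleFoot c ρ x = ((dist x c - ρ) / dist x c) • (x - c) := by
      refine plane_ext ?_ ?_ <;>
      · simp only [PiLp.sub_apply, PiLp.smul_apply, smul_eq_mul, circleFoot_apply]
        field_simp
        ring
    rw [dist_eq_norm, h1, norm_smul, Real.norm_eq_abs, abs_div, abs_of_pos hN, ← dist_eq_norm]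
    field_simp
  rw [sign_eq_one_iff, sign_eq_neg_one_iff]
  show dist x (circleFoot c ρ x) < δ ↔ _
  rw [e, abs_lt]
  constructor <;> rintro ⟨h1, h2⟩ <;> constructor <;> linarith

/-- For every curve of the family there is a tame map to which a nearest point of the curve can
be compared. -/
theorem exists_tameFoot (f : Quad) :
    ∃ (π : Plane → Plane) (X : Set Plane), TameFoot π ∧ X.Finite ∧
      (∀ δ, TameSet {x | dist x (π x) < δ}) ∧
      ∀ x ∉ X, ∀ q, f.eval q = 0 → ¬ f.Critical q →
        (∀ᶠ y in 𝓝 q, f.eval y = 0 → dist x q ≤ dist x y) → π x = q := by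
  by_cases ha : f.a = 0
  · by_cases hm : f.b ^ 2 + f.c ^ 2 = 0
    · have hbz : f.b = 0 := by nlinarith [sq_nonneg f.b, sq_nonneg f.c]
      have hcz : f.c = 0 := by nlinarith [sq_nonneg f.b, sq_nonneg f.c]
      -- A constant function has no noncritical zeros, so any foot map will do; likewise below for a
      -- circle of nonpositive squared radius.
      refine ⟨fun _ => 0, ∅, TameFoot.const 0, Set.finite_empty, TameSet.ball 0, ?_⟩
      intro x _ q _ hc
      exact absurd ⟨by rw [ha, hbz]; ring, by rw [ha, hcz]; ring⟩ hc
    · refine ⟨lineFoot f.b f.c f.d, ∅, TameFoot.line f.d hm, Set.finite_empty,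
        lineFoot_dist_tame f.d hm, ?_⟩
      intro x _ q hq _ hmin
      simp only [Quad.eval, ha, zero_mul, zero_add] at hq hmin
      exact lineFoot_eq_of_localMin hm hq hmin
  · have hev := Quad.eval_eq_of_a_ne_zero ha
    set c : Plane := !₂[-f.b / (2 * f.a), -f.c / (2 * f.a)] with hc
    set k := (f.b ^ 2 + f.c ^ 2) / (4 * f.a ^ 2) - f.d / f.a with hk
    have hz : ∀ x, f.eval x = 0 ↔ dist x c ^ 2 = k := fun x => by
      rw [hev, mul_eq_zero, or_iff_right ha, sub_eq_zero]
    rcases le_or_gt k 0 with h | h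
    · refine ⟨fun _ => 0, ∅, TameFoot.const 0, Set.finite_empty, TameSet.ball 0, ?_⟩
      intro x _ q hq hcrit
      have hq := (hz q).1 hq
      have h0 : dist q c = 0 := by
        have := sq_nonneg (dist q c)
        exact pow_eq_zero_iff (two_ne_zero) |>.1 (by linarith)
      rw [dist_eq_zero] at h0
      refine absurd ⟨?_, ?_⟩ hcrit
      · rw [h0]; simp [hc]; field_simp; ring
      · rw [h0]; simp [hc]; field_simp; ring
    · have hρ : 0 < √k := Real.sqrt_pos.2 h
      have hsq : √k ^ 2 = k := Real.sq_sqrt h.le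
      refine ⟨circleFoot c √k, {c}, TameFoot.circle c _, Set.finite_singleton c,
        circleFoot_dist_tame c _, ?_⟩
      intro x hx q hq _ hmin
      simp only [hz] at hq hmin
      exact circleFoot_eq_of_localMin hρ hx (by rw [hsq, hq]) (by rw [hsq]; exact hmin)

/-! ### Geometry of a triangulation -/

theorem IsAff.of_affineMap (f : Plane →ᵃ[ℝ] ℝ) : IsAff f := by
  refine ⟨f.linear !₂[1, 0], f.linear !₂[0, 1], f 0, fun x => ?_⟩
  have hx : x = x 0 • !₂[1, 0] + x 1 • (!₂[0, 1] : Plane) := plane_ext (by simp) (by simp)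
  have h1 : f x = f.linear x + f 0 := by
    have := congrFun f.decomp x
    simpa using this
  have h2 : f.linear x = x 0 * f.linear !₂[1, 0] + x 1 * f.linear !₂[0, 1] := by
    conv_lhs => rw [hx]
    rw [map_add, map_smul, map_smul, smul_eq_mul, smul_eq_mul]
  rw [h1, h2]; ring

variable {n : ℕ} {p : Polygon Plane n} {𝒯 : Finset (Finset (Fin n))}

/-- Barycentric coordinates of a triangle. -/
theorem IsTriangulation.exists_basis (hT : IsTriangulation p 𝒯) {t : Finset (Fin n)} (ht : t ∈ 𝒯) :
    ∃ b : AffineBasis t ℝ Plane, (∀ i, b i = p.vertices i) ∧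
      hull p t = {x | ∀ i, 0 ≤ b.coord i x} := by
  have hai := hT.affineIndependent t ht
  have hspan : affineSpan ℝ (Set.range fun i : t => p.vertices i) = ⊤ := by
    rw [hai.affineSpan_eq_top_iff_card_eq_finrank_add_one]
    simp [hT.card_eq t ht]
  refine ⟨⟨fun i : t => p.vertices i, hai, hspan⟩, fun i => rfl, ?_⟩
  rw [← AffineBasis.convexHull_eq_nonneg_coord, hull]
  congr 1
  ext x
  simp only [Set.mem_image, Finset.mem_coe, Set.mem_range, Subtype.exists]
  constructor <;> rintro ⟨i, hi, rfl⟩ <;> exact ⟨i, hi, rfl⟩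

theorem IsTriangulation.linTame_hull (hT : IsTriangulation p 𝒯) {t : Finset (Fin n)}
    (ht : t ∈ 𝒯) : LinTame (hull p t) := by
  obtain ⟨b, -, hb⟩ := hT.exists_basis ht
  refine ⟨Set.range fun i => (b.coord i : Plane → ℝ), Set.finite_range _, ?_, ?_⟩
  · rintro _ ⟨i, rfl⟩
    exact IsAff.of_affineMap _
  · intro x y hxy hx
    rw [hb] at hx ⊢
    intro i
    have h1 := hxy _ ⟨i, rfl⟩
    by_contra h
    simp only [sign_neg (not_le.1 h)] at h1
    rw [sign_eq_neg_one_iff] at h1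
    exact absurd (hx i) (not_le.2 h1)

theorem IsTriangulation.linTame_region (hT : IsTriangulation p 𝒯) : LinTame (region p) := by
  rw [← hT.iUnion_eq]
  exact LinTame.biUnion (s := (𝒯 : Set (Finset (Fin n)))) 𝒯.finite_toSet
    fun t ht => hT.linTame_hull ht

theorem isCompact_hull (p : Polygon Plane n) (t : Finset (Fin n)) : IsCompact (hull p t) :=
  (t.finite_toSet.image _).isCompact_convexHull ℝ

theorem convex_hull (p : Polygon Plane n) (t : Finset (Fin n)) : Convex ℝ (hull p t) :=
  convex_convexHull ℝ _

theorem IsTriangulation.isCompact_region (hT : IsTriangulation p 𝒯) : IsCompact (region p) := by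
  rw [← hT.iUnion_eq]
  exact 𝒯.isCompact_biUnion fun t _ => isCompact_hull p t

theorem IsTriangulation.hull_subset (hT : IsTriangulation p 𝒯) {t : Finset (Fin n)} (ht : t ∈ 𝒯) :
    hull p t ⊆ region p := by
  rw [← hT.iUnion_eq]
  exact Set.subset_biUnion_of_mem (u := fun t => hull p t) ht

/-- An edge of a triangle is cut out by an affine function, and near an inner point of the edge
the triangle is a half plane. -/
theorem IsTriangulation.exists_edge_function (hT : IsTriangulation p 𝒯) {t e : Finset (Fin n)}
    (ht : t ∈ 𝒯) (he : e ⊆ t) (hcard : e.card = 2) :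
    ∃ l : Plane →ᵃ[ℝ] ℝ, (∀ x ∈ hull p t, 0 ≤ l x) ∧ (∀ x ∈ hull p t, l x = 0 ↔ x ∈ hull p e) ∧
      ∀ z ∈ hull p e, (∀ k, z ≠ p.vertices k) → ∀ m, 0 ≤ l m →
        ∀ᶠ ε : ℝ in 𝓝[>] 0, AffineMap.lineMap z m ε ∈ hull p t := by
  obtain ⟨b, hbv, hb⟩ := hT.exists_basis ht
  obtain ⟨i, j, hij, rfl⟩ := Finset.card_eq_two.1 hcard
  have hi : i ∈ t := he (by simp)
  have hj : j ∈ t := he (by simp)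
  obtain ⟨k, hk, hke⟩ : ∃ k ∈ t, k ∉ ({i, j} : Finset (Fin n)) := by
    by_contra h
    push Not at h
    have := Finset.card_le_card (show t ⊆ {i, j} from h)
    rw [hT.card_eq t ht, hcard] at this
    omega
  simp only [Finset.mem_insert, Finset.mem_singleton, not_or] at hke
  have ht3 : ∀ m : t, m = ⟨i, hi⟩ ∨ m = ⟨j, hj⟩ ∨ m = ⟨k, hk⟩ := by
    have hsub : ({i, j, k} : Finset (Fin n)) ⊆ t := by
      intro m hm
      simp only [Finset.mem_insert, Finset.mem_singleton] at hm
      rcases hm with rfl | rfl | rfl <;> assumption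
    have heq := Finset.eq_of_subset_of_card_le hsub (by
      rw [hT.card_eq t ht, Finset.card_eq_three.2 ⟨i, j, k, hij, Ne.symm hke.1, Ne.symm hke.2, rfl⟩])
    rintro ⟨m, hm⟩
    rw [← heq] at hm
    simp only [Finset.mem_insert, Finset.mem_singleton] at hm
    simpa [Subtype.ext_iff] using hm
  have hedge : hull p {i, j} = segment ℝ (p.vertices i) (p.vertices j) := by
    rw [hull, Finset.coe_insert, Finset.coe_singleton, Set.image_pair, convexHull_pair]
  set I : t := ⟨i, hi⟩ with hI
  set J : t := ⟨j, hj⟩ with hJ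
  set K : t := ⟨k, hk⟩ with hK
  have hIJ : I ≠ J := fun h => hij (congrArg Subtype.val h)
  have hKI : K ≠ I := fun h => hke.1 (congrArg Subtype.val h)
  have hKJ : K ≠ J := fun h => hke.2 (congrArg Subtype.val h)
  have hcoord : ∀ s : ℝ, ∀ m : t, b.coord m (AffineMap.lineMap (p.vertices i) (p.vertices j) s) =
      (1 - s) * (if m = I then 1 else 0) + s * (if m = J then 1 else 0) := by
    intro s m
    have e1 : p.vertices i = b I := (hbv I).symm
    have e2 : p.vertices j = b J := (hbv J).symm
    rw [e1, e2, AffineMap.apply_lineMap, AffineMap.lineMap_apply_ring', b.coord_apply,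
      b.coord_apply]
    ring
  -- The function is the barycentric coordinate of the vertex opposite the edge.
  refine ⟨b.coord K, fun x hx => ?_, fun x hx => ⟨fun h0 => ?_, fun h => ?_⟩, ?_⟩
  · rw [hb] at hx; exact hx K
  · have hxx := hx
    rw [hb] at hx
    have hsum : b.coord I x + b.coord J x = 1 := by
      have := b.sum_coord_apply_eq_one x
      rw [← this]
      have huniv : (Finset.univ : Finset t) = {I, J, K} := by
        ext m; simpa using ht3 m
      rw [huniv, Finset.sum_insert (by simp [hIJ, hKI.symm]), Finset.sum_insert (by simp [hKJ.symm]),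
        Finset.sum_singleton, h0, add_zero]
    rw [hedge, segment_eq_image_lineMap]
    refine ⟨b.coord J x, ⟨hx J, by linarith [hx I]⟩, ?_⟩
    apply b.ext_elem
    intro m
    show b.coord m _ = b.coord m x
    rw [hcoord]
    rcases ht3 m with rfl | rfl | rfl
    · simp [hIJ]; linarith
    · simp [hIJ.symm]
    · simp [hKI, hKJ, h0]
  · rw [hedge, segment_eq_image_lineMap] at h
    obtain ⟨s, -, rfl⟩ := h
    rw [hcoord]; simp [hKI, hKJ]
  · intro z hz hzv m hm
    rw [hedge, segment_eq_image_lineMap] at hz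
    obtain ⟨s, ⟨hs0, hs1⟩, rfl⟩ := hz
    have hs0 : 0 < s := lt_of_le_of_ne hs0 fun h => hzv i (by rw [← h]; simp)
    have hs1 : s < 1 := lt_of_le_of_ne hs1 fun h => hzv j (by rw [h]; simp)
    rw [hb]
    have hall : ∀ q : t, ∀ᶠ ε : ℝ in 𝓝[>] 0, 0 ≤ b.coord q
        (AffineMap.lineMap (AffineMap.lineMap (p.vertices i) (p.vertices j) s) m ε) := by
      intro q
      simp only [AffineMap.apply_lineMap (b.coord q) _ m, hcoord, AffineMap.lineMap_apply_ring']
      have hpos : ∀ c d : ℝ, 0 < c → ∀ᶠ ε : ℝ in 𝓝[>] 0, 0 ≤ ε * d + c := by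
        intro c d hc
        have : Tendsto (fun ε : ℝ => ε * d + c) (𝓝[>] 0) (𝓝 (0 * d + c)) :=
          ((by fun_prop : Continuous fun ε : ℝ => ε * d + c).tendsto 0).mono_left nhdsWithin_le_nhds
        filter_upwards [this.eventually_const_lt (u := 0) (by simpa using hc)] with ε h using h.le
      -- The coordinates of `I` and `J` are positive at `z`, because `z` is not an endpoint, and
      -- stay so for small `ε`; the coordinate of `K` is `ε` times its nonnegative value at `m`.
      rcases ht3 q with rfl | rfl | rfl
      · exact hpos _ _ (by simp [hIJ]; linarith)
      · exact hpos _ _ (by simp [hIJ.symm]; linarith)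
      · filter_upwards [self_mem_nhdsWithin] with ε hε
        have : 0 ≤ ε * b.coord K m := mul_nonneg (le_of_lt hε) hm
        simpa [hKI, hKJ] using this
    exact eventually_all.2 hall

/-- A shortest connection between two triangles through an inner point of their common edge is
straight. -/
theorem IsTriangulation.wbtw_of_minimal (hT : IsTriangulation p 𝒯) {t t' : Finset (Fin n)}
    (ht : t ∈ 𝒯) (ht' : t' ∈ 𝒯) (hcard : (t ∩ t').card = 2) {u z v : Plane}
    (hz : z ∈ hull p (t ∩ t')) (hzv : ∀ k, z ≠ p.vertices k) (hu : u ∈ hull p t)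
    (hv : v ∈ hull p t')
    (hmin : ∀ y ∈ hull p (t ∩ t'), dist u z + dist z v ≤ dist u y + dist y v) : Wbtw ℝ u z v := by
  obtain ⟨l, hl1, hl2, hl3⟩ := hT.exists_edge_function ht Finset.inter_subset_left hcard
  have hinter := hT.inter_eq t ht t' ht'
  have hz2 : z ∈ hull p t ∩ hull p t' := by rw [hinter]; exact hz
  have hlz : l z = 0 := (hl2 z hz2.1).2 hz
  have hlm : ∀ (m : Plane) (ε : ℝ), l (AffineMap.lineMap z m ε) = ε * l m := by
    intro m ε
    rw [AffineMap.apply_lineMap, AffineMap.lineMap_apply_ring', hlz]; ring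
  have hunit : ∀ᶠ ε : ℝ in 𝓝[>] 0, ε < 1 :=
    nhdsWithin_le_nhds (eventually_lt_nhds one_pos)
  -- If `v` were strictly on the side of `t`, the segment from `z` towards `v` would start inside
  -- both triangles, hence on the common edge, where `l` vanishes.
  have hlv : l v ≤ 0 := by
    by_contra hpos
    push Not at hpos
    obtain ⟨ε, h1, h2, h3⟩ := ((hl3 z hz hzv v hpos.le).and
      (hunit.and (self_mem_nhdsWithin (s := Set.Ioi (0 : ℝ))))).exists
    have h4 : AffineMap.lineMap z v ε ∈ hull p t' :=
      (convex_hull p t').lineMap_mem hz2.2 hv ⟨le_of_lt h3, h2.le⟩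
    have h5 := (hl2 _ h1).2 (hinter ▸ ⟨h1, h4⟩)
    rw [hlm] at h5
    exact absurd h5 (mul_pos h3 hpos).ne'
  have hlu : 0 ≤ l u := hl1 u hu
  -- `m` is where the straight segment meets the line of the edge, perhaps outside the edge. A small
  -- step from `z` towards `m` stays on the edge, and convexity of the distance then transfers
  -- minimality to `m`.
  obtain ⟨m, hm, hlm0⟩ : ∃ m ∈ segment ℝ u v, l m = 0 := by
    by_cases h0 : l u = 0
    · exact ⟨u, left_mem_segment ℝ u v, h0⟩
    · have hpos : 0 < l u := lt_of_le_of_ne hlu (Ne.symm h0)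
      rw [segment_eq_image_lineMap]
      refine ⟨_, ⟨l u / (l u - l v), ⟨by apply div_nonneg <;> linarith, ?_⟩, rfl⟩, ?_⟩
      · rw [div_le_one (by linarith)]; linarith
      · rw [AffineMap.apply_lineMap, AffineMap.lineMap_apply_ring']
        have : l u - l v ≠ 0 := by linarith
        field_simp
        ring
  obtain ⟨ε, h1, h2, h3⟩ := ((hl3 z hz hzv m hlm0.ge).and
    (hunit.and (self_mem_nhdsWithin (s := Set.Ioi (0 : ℝ))))).exists
  have h3 : 0 < ε := h3
  have hmem := (hl2 _ h1).1 (by rw [hlm, hlm0, mul_zero])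
  have hc := hmin _ hmem
  have hconv : ∀ w : Plane, dist (AffineMap.lineMap z m ε) w ≤ (1 - ε) * dist z w + ε * dist m w := by
    intro w
    have := (convexOn_dist w (convex_univ (𝕜 := ℝ))).2 (Set.mem_univ z) (Set.mem_univ m)
      (by linarith : 0 ≤ 1 - ε) h3.le (by ring)
    rw [AffineMap.lineMap_apply_module]
    simpa using this
  have hmd : dist u m + dist m v = dist u v := dist_add_dist_of_mem_segment hm
  have c1 := hconv u
  have c2 := hconv v
  rw [dist_comm _ u, dist_comm _ u, dist_comm _ u] at c1
  have hfin : dist u z + dist z v ≤ dist u v := by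
    have : ε * (dist u z + dist z v) ≤ ε * dist u v := by rw [← hmd]; linarith
    exact le_of_mul_le_mul_left this h3
  exact dist_add_dist_eq_iff.1 (le_antisymm hfin (dist_triangle u z v))

/-! ### The distance of the polygon and paths through triangles -/

theorem chainLength_append (a : List Plane) (w : Plane) (b : List Plane) :
    chainLength (a ++ w :: b) = chainLength (a ++ [w]) + chainLength (w :: b) := by
  induction a with
  | nil => simp [chainLength]
  | cons x a ih =>
    cases a with
    | nil => simp [chainLength]
    | cons y a =>
      simp only [List.cons_append, chainLength] at ih ⊢
      rw [ih, add_assoc]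

theorem polyDist_le_of_segment {x y : Plane} (h : segment ℝ x y ⊆ region p) :
    polyDist p x y ≤ edist x y := by
  refine (iInf₂_le [] ?_).trans_eq ?_
  · simpa [chainThrough] using h
  · simp [chainThrough, chainLength]

/-- The middle point is a vertex because only vertices may be intermediate nodes when chains are
concatenated. -/
theorem polyDist_triangle (x y : Plane) (v : Fin n) :
    polyDist p x y ≤ polyDist p x (p.vertices v) + polyDist p (p.vertices v) y := by
  rw [polyDist.eq_def p x (p.vertices v), polyDist.eq_def p (p.vertices v) y]
  simp only [ENNReal.iInf_add, ENNReal.add_iInf]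
  refine le_iInf fun l' => le_iInf fun hl' => le_iInf fun l => le_iInf fun hl => ?_
  have e : chainThrough p x y (l ++ v :: l') =
      (x :: l.map p.vertices) ++ p.vertices v :: (l'.map p.vertices ++ [y]) := by
    simp [chainThrough]
  refine (iInf₂_le (l ++ v :: l') ?_).trans_eq ?_
  · rw [e, List.isChain_split]
    exact ⟨hl, hl'⟩
  · rw [e, chainLength_append]; rfl

/-- `y 0, …, y (k + 1)` is a sequence of points such that `T i` contains `y i` and `y (i + 1)`. -/
def IsTriPath (p : Polygon Plane n) (𝒯 : Finset (Finset (Fin n))) (k : ℕ) (T : ℕ → Finset (Fin n))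
    (y : ℕ → Plane) : Prop :=
  ∀ i ≤ k, T i ∈ 𝒯 ∧ y i ∈ hull p (T i) ∧ y (i + 1) ∈ hull p (T i)

/-- The length of the path through `y 0, …, y (k + 1)`. -/
noncomputable def pathLength (k : ℕ) (y : ℕ → Plane) : ℝ :=
  ∑ i ∈ Finset.range (k + 1), dist (y i) (y (i + 1))

theorem pathLength_nonneg (k : ℕ) (y : ℕ → Plane) : 0 ≤ pathLength k y :=
  Finset.sum_nonneg fun _ _ => dist_nonneg

theorem pathLength_succ (k : ℕ) (y : ℕ → Plane) :
    pathLength (k + 1) y = pathLength k y + dist (y (k + 1)) (y (k + 2)) :=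
  Finset.sum_range_succ _ _

theorem pathLength_cons (k : ℕ) (y : ℕ → Plane) :
    pathLength (k + 1) y = dist (y 0) (y 1) + pathLength k fun i => y (i + 1) := by
  rw [pathLength, Finset.sum_range_succ', add_comm]; rfl

theorem pathLength_add (j r : ℕ) (y : ℕ → Plane) :
    pathLength (j + r + 1) y = pathLength j y + pathLength r fun i => y (i + (j + 1)) := by
  unfold pathLength
  rw [show j + r + 1 + 1 = (j + 1) + (r + 1) by ring, Finset.sum_range_add]
  congr 1
  refine Finset.sum_congr rfl fun i _ => ?_
  simp only [show j + 1 + i = i + (j + 1) by ring, show i + 1 + (j + 1) = i + (j + 1) + 1 by ring]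

/-- Omit the entry with index `j + 1`. -/
def skip {α : Type*} (j : ℕ) (y : ℕ → α) (m : ℕ) : α := if m ≤ j then y m else y (m + 1)

theorem skip_of_le {α : Type*} {j m : ℕ} (y : ℕ → α) (h : m ≤ j) : skip j y m = y m := if_pos h

theorem skip_of_lt {α : Type*} {j m : ℕ} (y : ℕ → α) (h : j < m) : skip j y m = y (m + 1) :=
  if_neg (by omega)

/-- A shortcut: the path stays in `T j` one step longer, so the next triangle and the point `y (j +
1)` become superfluous. -/
theorem IsTriPath.skip {k j : ℕ} {T : ℕ → Finset (Fin n)} {y : ℕ → Plane}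
    (h : IsTriPath p 𝒯 (k + 1) T y) (hjk : j ≤ k) (hj : y (j + 2) ∈ hull p (T j)) :
    IsTriPath p 𝒯 k (skip j T) (skip j y) := by
  intro i hi
  rcases lt_trichotomy i j with hij | rfl | hij
  · rw [skip_of_le T hij.le, skip_of_le y hij.le, skip_of_le y hij]
    exact h i (by omega)
  · rw [skip_of_le T le_rfl, skip_of_le y le_rfl, skip_of_lt y (by omega)]
    exact ⟨(h i (by omega)).1, (h i (by omega)).2.1, hj⟩
  · rw [skip_of_lt T hij, skip_of_lt y hij, skip_of_lt y (by omega)]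
    exact h (i + 1) (by omega)

theorem pathLength_skip_le {j k : ℕ} (y : ℕ → Plane) (hjk : j ≤ k) :
    pathLength k (skip j y) ≤ pathLength (k + 1) y := by
  induction k, hjk using Nat.le_induction with
  | base =>
    have h1 : ∑ i ∈ Finset.range j, dist (skip j y i) (skip j y (i + 1)) =
        ∑ i ∈ Finset.range j, dist (y i) (y (i + 1)) :=
      Finset.sum_congr rfl fun i hi => by
        have := Finset.mem_range.1 hi
        rw [skip_of_le y this.le, skip_of_le y this]
    rw [pathLength_succ, pathLength, pathLength, Finset.sum_range_succ, Finset.sum_range_succ, h1,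
      skip_of_le y le_rfl, skip_of_lt y (by omega)]
    linarith [dist_triangle (y j) (y (j + 1)) (y (j + 2))]
  | succ k hjk ih =>
    rw [pathLength_succ, pathLength_succ (k + 1), skip_of_lt y (by omega : j < k + 1),
      skip_of_lt y (by omega : j < k + 2)]
    linarith

theorem segment_subset_union_of_wbtw {a b c : Plane} (h : Wbtw ℝ a b c) :
    segment ℝ a c ⊆ segment ℝ a b ∪ segment ℝ b c := by
  obtain ⟨s, ⟨hs0, hs1⟩, rfl⟩ := h
  set f : ℝ →ᵃ[ℝ] Plane := AffineMap.lineMap a c with hf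
  have e : ∀ u v : ℝ, u ≤ v → segment ℝ (f u) (f v) = f '' Set.Icc u v := fun u v huv => by
    rw [← image_segment, segment_eq_Icc huv]
  have h0 : f 0 = a := by simp [hf]
  have h1 : f 1 = c := by simp [hf]
  conv_lhs => rw [← h0, ← h1, e 0 1 zero_le_one]
  have e0 := e 0 s hs0
  have e1 := e s 1 hs1
  rw [h0] at e0
  rw [h1] at e1
  rw [e0, e1, ← Set.image_union, Set.Icc_union_Icc_eq_Icc hs0 hs1]

/-- A shortest path with prescribed sequence of triangles exists. -/
theorem IsTriPath.exists_minimal {k : ℕ} {T : ℕ → Finset (Fin n)} {y : ℕ → Plane}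
    (h : IsTriPath p 𝒯 k T y) : ∃ z : ℕ → Plane, IsTriPath p 𝒯 k T z ∧ z 0 = y 0 ∧
      z (k + 1) = y (k + 1) ∧ pathLength k z ≤ pathLength k y ∧
      ∀ j < k, ∀ w ∈ hull p (T j) ∩ hull p (T (j + 1)),
        dist (z j) (z (j + 1)) + dist (z (j + 1)) (z (j + 2)) ≤
          dist (z j) w + dist w (z (j + 2)) := by
  -- Coordinates beyond the end of the path are pinned as well, so that the set of competing
  -- sequences is a compact product over all of `ℕ`.
  set K : ℕ → Set Plane := fun i =>
    if i = 0 ∨ k < i then {y i} else hull p (T (i - 1)) ∩ hull p (T i) with hK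
  have hKc : IsCompact (Set.univ.pi K) := isCompact_univ_pi fun i => by
    simp only [hK]
    split_ifs
    · exact isCompact_singleton
    · exact (isCompact_hull p _).inter (isCompact_hull p _)
  have hKs : ∀ j < k, K (j + 1) = hull p (T j) ∩ hull p (T (j + 1)) := fun j hj => by
    simp only [hK]
    rw [if_neg (by omega)]; rfl
  have hy : y ∈ Set.univ.pi K := by
    rintro i -
    rcases i with _ | j
    · simp [hK]
    · rcases lt_or_ge j k with hj | hj
      · rw [hKs j hj]
        exact ⟨(h j hj.le).2.2, (h (j + 1) hj).2.1⟩
      · simp only [hK]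
        rw [if_pos (by omega)]; rfl
  have hcont : Continuous fun y : ℕ → Plane => pathLength k y := by
    unfold pathLength; fun_prop
  obtain ⟨z, hz, hmin⟩ := hKc.exists_isMinOn ⟨y, hy⟩ hcont.continuousOn
  have hz0 : z 0 = y 0 := by simpa [hK] using hz 0 trivial
  have hzk : z (k + 1) = y (k + 1) := by
    have := hz (k + 1) trivial
    simp only [hK] at this
    rwa [if_pos (by omega)] at this
  have hzi : ∀ j < k, z (j + 1) ∈ hull p (T j) ∩ hull p (T (j + 1)) := fun j hj => by
    rw [← hKs j hj]; exact hz _ trivial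
  refine ⟨z, ?_, hz0, hzk, hmin hy, ?_⟩
  · intro i hi
    refine ⟨(h i hi).1, ?_, ?_⟩
    · rcases i with _ | j
      · rw [hz0]; exact (h 0 hi).2.1
      · exact (hzi j (by omega)).2
    · rcases hi.eq_or_lt with rfl | hi
      · rw [hzk]; exact (h i le_rfl).2.2
      · exact (hzi i hi).1
  · intro j hj w hw
    have hmem : Function.update z (j + 1) w ∈ Set.univ.pi K := by
      rintro i -
      by_cases hi : i = j + 1
      · subst hi
        rw [Function.update_self, hKs j hj]; exact hw
      · rw [Function.update_of_ne hi]; exact hz i trivial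
    have hle := hmin hmem
    simp only [Set.mem_ofPred_eq, pathLength] at hle
    have hsub : ({j, j + 1} : Finset ℕ) ⊆ Finset.range (k + 1) := by
      intro i hi
      simp only [Finset.mem_insert, Finset.mem_singleton] at hi
      rw [Finset.mem_range]; omega
    rw [← Finset.sum_sdiff hsub, ← Finset.sum_sdiff hsub, Finset.sum_pair (by omega),
      Finset.sum_pair (by omega)] at hle
    have heq : ∑ i ∈ Finset.range (k + 1) \ {j, j + 1},
        dist (Function.update z (j + 1) w i) (Function.update z (j + 1) w (i + 1)) =
        ∑ i ∈ Finset.range (k + 1) \ {j, j + 1}, dist (z i) (z (i + 1)) := by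
      refine Finset.sum_congr rfl fun i hi => ?_
      simp only [Finset.mem_sdiff, Finset.mem_insert, Finset.mem_singleton, not_or] at hi
      rw [Function.update_of_ne (by omega), Function.update_of_ne (by omega)]
    rw [heq, Function.update_self, Function.update_of_ne (by omega),
      Function.update_of_ne (by omega)] at hle
    exact le_of_add_le_add_left hle

/-- The distance of the polygon is at most the length of any path through triangles. -/
theorem IsTriangulation.polyDist_le_pathLength (hT : IsTriangulation p 𝒯) :
    ∀ (k : ℕ) (T : ℕ → Finset (Fin n)) (y : ℕ → Plane), IsTriPath p 𝒯 k T y →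
      polyDist p (y 0) (y (k + 1)) ≤ ENNReal.ofReal (pathLength k y) := by
  intro k
  induction k using Nat.strong_induction_on with
  | _ k ih =>
  intro T y hy
  obtain ⟨z, hz, hz0, hzk, hle, hmin⟩ := hy.exists_minimal
  rw [← hz0, ← hzk]
  refine le_trans ?_ (ENNReal.ofReal_le_ofReal hle)
  have hseg : ∀ i ≤ k, segment ℝ (z i) (z (i + 1)) ⊆ region p := fun i hi =>
    ((convex_hull p _).segment_subset (hz i hi).2.1 (hz i hi).2.2).trans (hT.hull_subset (hz i hi).1)
  rcases k with _ | k
  · refine (polyDist_le_of_segment (hseg 0 le_rfl)).trans_eq ?_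
    simp [pathLength, edist_dist]
  -- Three reductions shorten the path: a triangle can be skipped, the first step is trivial, or an
  -- intermediate point is a vertex and the path splits there. In the remaining case the minimal
  -- path is straight at every intermediate point.
  by_cases h1 : ∃ j ≤ k, z (j + 2) ∈ hull p (T j)
  · obtain ⟨j, hj, hmem⟩ := h1
    have := ih k (by omega) _ _ (hz.skip hj hmem)
    rw [skip_of_le z (by omega), skip_of_lt z (by omega)] at this
    exact this.trans (ENNReal.ofReal_le_ofReal (pathLength_skip_le z hj))
  push Not at h1
  by_cases h0 : z 0 = z 1
  · have := ih k (by omega) (fun i => T (i + 1)) (fun i => z (i + 1))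
      fun i hi => hz (i + 1) (by omega)
    rw [h0, pathLength_cons, h0, dist_self, zero_add]
    exact this
  by_cases hv : ∃ j ≤ k, ∃ v, z (j + 1) = p.vertices v
  · obtain ⟨j, hj, v, hv⟩ := hv
    have h2 := ih j (by omega) T z fun i hi => hz i (by omega)
    have h3 := ih (k - j) (by omega) (fun i => T (i + (j + 1))) (fun i => z (i + (j + 1)))
      fun i hi => by
        have := hz (i + (j + 1)) (by omega)
        rwa [show i + (j + 1) + 1 = i + 1 + (j + 1) by ring] at this
    simp only [zero_add] at h3
    rw [show k - j + 1 + (j + 1) = k + 1 + 1 by omega, hv] at h3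
    rw [hv] at h2
    refine (polyDist_triangle _ _ v).trans ((add_le_add h2 h3).trans_eq ?_)
    rw [← ENNReal.ofReal_add (pathLength_nonneg _ _) (pathLength_nonneg _ _), ← pathLength_add,
      show j + (k - j) + 1 = k + 1 by omega]
  push Not at hv
  have hstraight : ∀ j ≤ k, Wbtw ℝ (z j) (z (j + 1)) (z (j + 2)) := by
    intro j hj
    have a1 := hz j (by omega)
    have a2 := hz (j + 1) (by omega)
    have hne : T j ≠ T (j + 1) := fun he => h1 j hj (by rw [he]; exact a2.2.2)
    have hinter := hT.inter_eq _ a1.1 _ a2.1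
    have hmem : z (j + 1) ∈ hull p (T j ∩ T (j + 1)) := by
      rw [← hinter]; exact ⟨a1.2.2, a2.2.1⟩
    -- The triangles differ, they share the point `z (j + 1)`, and that point is not a vertex: their
    -- intersection has exactly two vertices.
    have hcard : (T j ∩ T (j + 1)).card = 2 := by
      have hlt : (T j ∩ T (j + 1)).card < 3 := by
        by_contra hge
        have e1 := Finset.eq_of_subset_of_card_le (Finset.inter_subset_left (s₁ := T j)
          (s₂ := T (j + 1))) (by rw [hT.card_eq _ a1.1]; omega)
        have e2 := Finset.eq_of_subset_of_card_le (Finset.inter_subset_right (s₁ := T j)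
          (s₂ := T (j + 1))) (by rw [hT.card_eq _ a2.1]; omega)
        exact hne (e1.symm.trans e2)
      have h0' : (T j ∩ T (j + 1)).card ≠ 0 := fun h => by
        rw [Finset.card_eq_zero.1 h] at hmem
        simp [hull] at hmem
      have h1' : (T j ∩ T (j + 1)).card ≠ 1 := fun h => by
        obtain ⟨v, hv'⟩ := Finset.card_eq_one.1 h
        rw [hv'] at hmem
        simp only [hull, Finset.coe_singleton, Set.image_singleton, convexHull_singleton,
          Set.mem_singleton_iff] at hmem
        exact hv j hj v hmem
      omega
    refine hT.wbtw_of_minimal a1.1 a2.1 hcard hmem (hv j hj) a1.2.1 a2.2.2 fun w hw => ?_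
    exact hmin j (by omega) w (by rw [hinter]; exact hw)
  -- Steps of length zero would stop straightness at consecutive triples from propagating to the
  -- whole path.
  have hne : ∀ j ≤ k, z j ≠ z (j + 1) := by
    rintro (_ | j) hj
    · exact h0
    · intro he
      exact h1 j (by omega) (he ▸ (hz j (by omega)).2.2)
  have key : ∀ j ≤ k + 1, (0 < j → Wbtw ℝ (z 0) (z j) (z (j + 1))) ∧
      segment ℝ (z 0) (z (j + 1)) ⊆ region p ∧ pathLength j z = dist (z 0) (z (j + 1)) := by
    intro j
    induction j with
    | zero =>
      intro hj
      exact ⟨fun h => absurd h (by omega), hseg 0 (by omega), by simp [pathLength]⟩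
    | succ j ihj =>
      intro hj
      obtain ⟨b1, b2, b3⟩ := ihj (by omega)
      have hw : Wbtw ℝ (z 0) (z (j + 1)) (z (j + 2)) := by
        rcases j.eq_zero_or_pos with rfl | hpos
        · exact hstraight 0 (by omega)
        · exact (b1 hpos).trans_expand_right (hstraight j (by omega)) (hne j (by omega))
      refine ⟨fun _ => hw, (segment_subset_union_of_wbtw hw).trans
        (Set.union_subset b2 (hseg (j + 1) hj)), ?_⟩
      rw [pathLength_succ, b3, hw.dist_add_dist]
  obtain ⟨-, c2, c3⟩ := key (k + 1) le_rfl
  rw [c3, ← edist_dist]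
  exact polyDist_le_of_segment c2

/-- A segment covered by triangles is a path through triangles. -/
theorem exists_triPath_of_segment (F : Finset (Finset (Fin n))) :
    ∀ (q x : Plane), F ⊆ 𝒯 → segment ℝ q x ⊆ ⋃ t ∈ F, hull p t →
      ∃ (k : ℕ) (T : ℕ → Finset (Fin n)) (y : ℕ → Plane), IsTriPath p 𝒯 k T y ∧ y 0 = q ∧
        y (k + 1) = x ∧ pathLength k y = dist q x := by
  induction F using Finset.strongInduction with
  | H F ih =>
  intro q x hF hseg
  have hq := hseg (left_mem_segment ℝ q x)
  simp only [Set.mem_iUnion] at hq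
  obtain ⟨t, ht, hqt⟩ := hq
  by_cases hx : x ∈ hull p t
  · refine ⟨0, fun _ => t, fun i => if i = 0 then q else x, ?_, by simp, by simp, by simp [pathLength]⟩
    intro i hi
    obtain rfl : i = 0 := by omega
    exact ⟨hF ht, by simpa using hqt, by simpa using hx⟩
  set f : ℝ →ᵃ[ℝ] Plane := AffineMap.lineMap q x with hf
  have hfc : Continuous f := AffineMap.lineMap_continuous
  have hcpt : IsCompact (Set.Icc 0 1 ∩ f ⁻¹' hull p t) :=
    isCompact_Icc.inter_right ((isCompact_hull p t).isClosed.preimage hfc)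
  -- `f s` is the last point of the segment in `t`. The rest is covered by the other triangles, and
  -- `f s` itself too since their union is closed.
  obtain ⟨s, ⟨hs, hst⟩, hmax⟩ := hcpt.exists_isMaxOn ⟨0, by simp, by simpa [hf] using hqt⟩
    continuousOn_id
  have hs1 : s < 1 := lt_of_le_of_ne hs.2 fun h => hx (by
    rw [h] at hst; simpa [hf] using hst)
  have hf1 : f 1 = x := by simp [hf]
  have hw : Wbtw ℝ q (f s) x := ⟨s, hs, rfl⟩
  have hclosed : IsClosed (⋃ t' ∈ F.erase t, hull p t') :=
    ((F.erase t).isCompact_biUnion fun t' _ => isCompact_hull p t').isClosed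
  have hsub : segment ℝ (f s) x ⊆ ⋃ t' ∈ F.erase t, hull p t' := by
    have h1 : f '' Set.Ioc s 1 ⊆ ⋃ t' ∈ F.erase t, hull p t' := by
      rintro _ ⟨u, hu, rfl⟩
      have hu' : u ∈ Set.Icc (0 : ℝ) 1 := ⟨hs.1.trans hu.1.le, hu.2⟩
      have h2 := hseg (show f u ∈ segment ℝ q x by
        rw [segment_eq_image_lineMap]; exact ⟨u, hu', rfl⟩)
      simp only [Set.mem_iUnion] at h2 ⊢
      obtain ⟨t', ht', hm⟩ := h2
      refine ⟨t', Finset.mem_erase.2 ⟨?_, ht'⟩, hm⟩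
      rintro rfl
      exact absurd (hmax ⟨hu', hm⟩) (not_le.2 hu.1)
    rw [← hf1, ← image_segment, segment_eq_Icc hs1.le, ← closure_Ioc hs1.ne]
    exact (image_closure_subset_closure_image hfc).trans (hclosed.closure_subset_iff.2 h1)
  obtain ⟨k, T, y, h1, h2, h3, h4⟩ := ih _ (Finset.erase_ssubset ht) (f s) x
    ((Finset.erase_subset _ _).trans hF) hsub
  refine ⟨k + 1, fun i => Nat.casesOn i t T, fun i => Nat.casesOn i q y, ?_, rfl, h3, ?_⟩
  · rintro (_ | i) hi
    · exact ⟨hF ht, hqt, by simpa [h2] using hst⟩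
    · exact h1 i (by omega)
  · rw [pathLength_cons]
    show dist q (y 0) + pathLength k y = _
    rw [h4, h2, hw.dist_add_dist]

/-- If `a` and `b` lie in a common triangle and `x` is visible from `b`, then the distance from `a`
to `x` is at most the length of the path through `b`. -/
theorem IsTriangulation.polyDist_le_add (hT : IsTriangulation p 𝒯) {t : Finset (Fin n)}
    (ht : t ∈ 𝒯) {a b x : Plane} (ha : a ∈ hull p t) (hb : b ∈ hull p t)
    (hx : segment ℝ b x ⊆ region p) :
    polyDist p a x ≤ ENNReal.ofReal (dist a b + dist b x) := by
  rw [← hT.iUnion_eq] at hx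
  obtain ⟨k, T, y, h1, h2, h3, h4⟩ := exists_triPath_of_segment 𝒯 b x subset_rfl hx
  have := hT.polyDist_le_pathLength (k + 1) (fun i => Nat.casesOn i t T)
    (fun i => Nat.casesOn i a y) (by
      rintro (_ | i) hi
      · exact ⟨ht, ha, by simpa [h2] using hb⟩
      · exact h1 i (by omega))
  rw [pathLength_cons] at this
  change polyDist p a (y (k + 1)) ≤ ENNReal.ofReal (dist a (y 0) + pathLength k y) at this
  rwa [h3, h2, h4] at this

/-! ### Neighbourhoods of tame sets -/

/-- The finitely many closed triangles that miss `q` also miss a neighbourhood of `q`. -/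
theorem IsTriangulation.eventually_common (hT : IsTriangulation p 𝒯) (q : Plane) :
    ∀ᶠ a in 𝓝 q, a ∈ region p → ∃ t ∈ 𝒯, a ∈ hull p t ∧ q ∈ hull p t := by
  have h : ∀ᶠ a in 𝓝 q, ∀ t ∈ 𝒯, a ∈ hull p t → q ∈ hull p t := by
    rw [Finset.eventually_all]
    intro t _
    by_cases hq : q ∈ hull p t
    · exact Eventually.of_forall fun _ _ => hq
    · filter_upwards [(isCompact_hull p t).isClosed.isOpen_compl.mem_nhds hq] with a ha h
      exact absurd h ha
  filter_upwards [h] with a ha haP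
  rw [← hT.iUnion_eq] at haP
  simp only [Set.mem_iUnion] at haP
  obtain ⟨t, ht, hat⟩ := haP
  exact ⟨t, ht, hat, ha t ht hat⟩

theorem edist_le_chainLength (L : List Plane) (a x : Plane) :
    edist a x ≤ chainLength (a :: (L ++ [x])) := by
  induction L generalizing a with
  | nil => simp [chainLength]
  | cons b L ih =>
    simp only [List.cons_append, chainLength]
    exact (edist_triangle a b x).trans (add_le_add_right (ih b) _)

/-- Visibility is stable near a point if no vertex lies on the line of sight. -/
theorem IsTriangulation.eventually_visible (hT : IsTriangulation p 𝒯) {q x : Plane}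
    (hx : segment ℝ q x ⊆ region p) (hv : ∀ v, p.vertices v ∉ segment ℝ q x) :
    ∀ᶠ a in 𝓝 q, a ∈ region p → segment ℝ a x ⊆ region p := by
  have hlt : ∀ᶠ a in 𝓝 q, ∀ v : Fin n,
      dist a q + dist q x < dist a (p.vertices v) + dist (p.vertices v) x := by
    rw [eventually_all]
    intro v
    have h0 : dist q q + dist q x < dist q (p.vertices v) + dist (p.vertices v) x := by
      rw [dist_self, zero_add]
      refine lt_of_le_of_ne (dist_triangle _ _ _) fun h => hv v ?_
      exact mem_segment_iff_wbtw.2 (dist_add_dist_eq_iff.1 h.symm)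
    exact ContinuousAt.eventually_lt (by fun_prop) (by fun_prop) h0
  filter_upwards [hlt, hT.eventually_common q] with a ha hc haP
  obtain ⟨t, ht, hat, hqt⟩ := hc haP
  have h1 := hT.polyDist_le_add ht hat hqt hx
  -- `m` separates the length via `q` from all detours through a vertex. Some admissible chain is
  -- shorter than `m`, so it has no intermediate vertex and is the segment itself.
  obtain ⟨m, hm1, hm2⟩ := Order.exists_between_finsets {dist a q + dist q x}
    (Finset.univ.image fun v : Fin n => dist a (p.vertices v) + dist (p.vertices v) x) (by
      intro u hu w hw
      rw [Finset.mem_singleton] at hu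
      rw [Finset.mem_image] at hw
      obtain ⟨v, -, rfl⟩ := hw
      rw [hu]; exact ha v)
  have hm1 := hm1 _ (Finset.mem_singleton_self _)
  have hm0 : 0 < m := lt_of_le_of_lt (by positivity) hm1
  have h2 := h1.trans_lt ((ENNReal.ofReal_lt_ofReal_iff hm0).2 hm1)
  simp only [polyDist, iInf_lt_iff] at h2
  obtain ⟨l, hl, hlen⟩ := h2
  rcases l with _ | ⟨v, l⟩
  · simpa [chainThrough] using hl
  · exfalso
    have h3 := hm2 _ (Finset.mem_image_of_mem _ (Finset.mem_univ v))
    have h4 : edist a (p.vertices v) + edist (p.vertices v) x ≤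
        chainLength (chainThrough p a x (v :: l)) := by
      simp only [chainThrough, List.map_cons, List.cons_append, chainLength]
      exact add_le_add_right (edist_le_chainLength _ _ _) _
    rw [edist_dist, edist_dist, ← ENNReal.ofReal_add dist_nonneg dist_nonneg] at h4
    exact absurd (h4.trans_lt hlen) (not_lt.2 (ENNReal.ofReal_le_ofReal h3.le))

theorem tameSet_add_edist_lt (D : ENNReal) (w : Plane) (δ : ℝ) :
    TameSet {x | D + edist x w < ENNReal.ofReal δ} := by
  by_cases hD : D = ⊤
  · convert TameSet.empty using 1
    ext x; simp [hD]
  · convert TameSet.ball w (δ - D.toReal) using 1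
    ext x
    have h0 : 0 ≤ D.toReal + dist x w := by positivity
    simp only [Set.mem_ofPred_eq]
    conv_lhs => rw [← ENNReal.ofReal_toReal hD, edist_dist, ← ENNReal.ofReal_add (by positivity) dist_nonneg,
      ENNReal.ofReal_lt_ofReal_iff_of_nonneg h0]
    constructor <;> intro h <;> linarith

/-- The points at distance less than `δ` from a subset of the polygon. -/
def thickening (p : Polygon Plane n) (δ : ℝ) (Q : Set Plane) : Set Plane :=
  {x | x ∈ region p ∧ ∃ q ∈ Q, polyDist p q x < ENNReal.ofReal δ}

/-- The strict inequality leaves room to replace `q` by a nearby point of `Q` in a common triangle.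
That point need not see `x`; the path through `q` bounds its polygon distance. -/
theorem IsTriangulation.mem_thickening_of_closure (hT : IsTriangulation p 𝒯) {Q : Set Plane}
    (hQ : Q ⊆ region p) {δ : ℝ} {x q : Plane} (hq : q ∈ closure Q)
    (hx : segment ℝ x q ⊆ region p) (hlt : dist x q < δ) : x ∈ thickening p δ Q := by
  have hnear : ∀ᶠ a in 𝓝 q, dist a q + dist q x < δ :=
    ContinuousAt.eventually_lt (by fun_prop) (by fun_prop) (by simpa [dist_comm] using hlt)
  obtain ⟨a, haQ, ha1, ha2⟩ := ((mem_closure_iff_frequently.1 hq).and_eventually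
    (hnear.and (hT.eventually_common q))).exists
  obtain ⟨t, ht, hat, hqt⟩ := ha2 (hQ haQ)
  refine ⟨hx (left_mem_segment ℝ x q), a, haQ, ?_⟩
  rw [segment_symm] at hx
  refine (hT.polyDist_le_add ht hat hqt hx).trans_lt ?_
  rwa [ENNReal.ofReal_lt_ofReal_iff_of_nonneg (by positivity)]

theorem mem_thickening_of_vertex {Q : Set Plane} {δ : ℝ} {x : Plane} {v : Fin n}
    (hx : segment ℝ x (p.vertices v) ⊆ region p)
    (hlt : (⨅ q ∈ Q, polyDist p q (p.vertices v)) + edist x (p.vertices v) < ENNReal.ofReal δ) :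
    x ∈ thickening p δ Q := by
  rw [← lt_tsub_iff_right] at hlt
  simp only [iInf_lt_iff] at hlt
  obtain ⟨q, hq, hlt⟩ := hlt
  rw [lt_tsub_iff_right] at hlt
  refine ⟨hx (left_mem_segment ℝ _ _), q, hq, ?_⟩
  refine ((polyDist_triangle q x v).trans (add_le_add_right (polyDist_le_of_segment ?_) _)).trans_lt
    ?_
  · rwa [segment_symm]
  · rwa [edist_comm]

/-- A point near `Q` is near a vertex, or sees a near point of `Q`. -/
theorem mem_thickening_cases {Q : Set Plane} {δ : ℝ} {x : Plane} (h : x ∈ thickening p δ Q) :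
    (∃ v, segment ℝ x (p.vertices v) ⊆ region p ∧
      (⨅ q ∈ Q, polyDist p q (p.vertices v)) + edist x (p.vertices v) < ENNReal.ofReal δ) ∨
    ∃ q ∈ Q, segment ℝ x q ⊆ region p ∧ dist x q < δ := by
  obtain ⟨-, q, hq, hlt⟩ := h
  simp only [polyDist, iInf_lt_iff] at hlt
  obtain ⟨l, hl, hlen⟩ := hlt
  -- The cases are a chain without intermediate vertex and a chain with last vertex `v`.
  rcases l.eq_nil_or_concat with rfl | ⟨l, v, rfl⟩
  · right
    refine ⟨q, hq, by rw [segment_symm]; simpa [chainThrough] using hl, ?_⟩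
    have : edist q x < ENNReal.ofReal δ := by simpa [chainThrough, chainLength] using hlen
    rw [edist_dist, ENNReal.ofReal_lt_ofReal_iff_of_nonneg dist_nonneg] at this
    rwa [dist_comm]
  · left
    have e : chainThrough p q x (l ++ [v]) = (q :: l.map p.vertices) ++ p.vertices v :: [x] := by
      simp [chainThrough]
    rw [List.concat_eq_append] at hl hlen
    rw [e] at hl hlen
    rw [List.isChain_split] at hl
    rw [chainLength_append] at hlen
    refine ⟨v, by rw [segment_symm]; simpa using hl.2, lt_of_le_of_lt (add_le_add ?_ ?_) hlen⟩
    · exact (iInf₂_le q hq).trans (iInf₂_le l hl.1)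
    · simp [chainLength, edist_comm]

theorem isClosed_visible {P : Set Plane} (hP : IsClosed P) (x : Plane) :
    IsClosed {a | segment ℝ x a ⊆ P} := by
  have : {a | segment ℝ x a ⊆ P} =
      ⋂ t ∈ Set.Icc (0 : ℝ) 1, {a : Plane | x + t • (a - x) ∈ P} := by
    ext a
    simp only [Set.mem_ofPred_eq, Set.mem_iInter, segment_eq_image', Set.image_subset_iff]
    rfl
  rw [this]
  exact isClosed_biInter fun t _ => hP.preimage (by fun_prop)

/-- The set of points at distance less than `δ` from a tame subset of the polygon is tame. -/
theorem IsTriangulation.tameSet_thickening (hT : IsTriangulation p 𝒯) {Q : Set Plane}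
    (hQt : TameSet Q) (hQ : Q ⊆ region p) (δ : ℝ) : TameSet (thickening p δ Q) := by
  rcases le_or_gt δ 0 with hδ | hδ
  · convert TameSet.empty using 1
    ext x
    simp [thickening, ENNReal.ofReal_of_nonpos hδ]
  have hPc := hT.isCompact_region
  have hPl := hT.linTame_region
  have hQP : closure Q ⊆ region p := hPc.isClosed.closure_subset_iff.2 hQ
  obtain ⟨F, E, hF, hE, hfr, hcrit, hloc, -⟩ := hQt.frontier_structure
  choose π X hπ hX hπd hπm using exists_tameFoot
  -- The pieces are the closure, points near a visible vertex, points near a visible exceptional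
  -- point, points near a visible foot, and a finite remainder where a foot map is not controlled.
  have hsplit : thickening p δ Q = closure Q ∪
      (⋃ v : Fin n, {x | segment ℝ x (p.vertices v) ⊆ region p} ∩
        {x | (⨅ q ∈ Q, polyDist p q (p.vertices v)) + edist x (p.vertices v) < ENNReal.ofReal δ}) ∪
      (⋃ e ∈ E ∩ closure Q, {x | segment ℝ x e ⊆ region p} ∩ {x | dist x e < δ}) ∪
      (⋃ f ∈ F, {x | π f x ∈ closure Q} ∩ {x | segment ℝ x (π f x) ⊆ region p} ∩
        {x | dist x (π f x) < δ}) ∪ ((⋃ f ∈ F, X f) ∩ thickening p δ Q) := by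
    apply Set.Subset.antisymm
    · intro x hxU
      by_contra hx
      simp only [Set.mem_union, Set.mem_iUnion, Set.mem_inter_iff, Set.mem_ofPred_eq, not_or,
        not_exists, not_and] at hx
      obtain ⟨⟨⟨⟨hxQ, hxv⟩, hxE⟩, hxF⟩, hxX⟩ := hx
      rcases mem_thickening_cases hxU with ⟨v, h1, h2⟩ | ⟨q, hq, hqx, hqd⟩
      · exact hxv v h1 h2
      have hKc : IsCompact (closure Q ∩ {a | segment ℝ x a ⊆ region p}) :=
        (hPc.of_isClosed_subset isClosed_closure hQP).inter_right
          (isClosed_visible hPc.isClosed x)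
      obtain ⟨q0, ⟨hq0, hvis⟩, hmin⟩ := hKc.exists_isMinOn ⟨q, subset_closure hq, hqx⟩
        (f := fun a => dist x a) (by fun_prop)
      have hvis : segment ℝ x q0 ⊆ region p := hvis
      have hd0 : dist x q0 < δ := (hmin ⟨subset_closure hq, hqx⟩).trans_lt hqd
      have hne : x ≠ q0 := fun h => hxQ (h ▸ hq0)
      -- A vertex on the sight line would place `x` in the vertex piece, since the path through it
      -- is no longer than `dist x q0`.
      have hnov : ∀ v, p.vertices v ∉ segment ℝ q0 x := by
        intro v hv
        rw [segment_symm] at hv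
        have hseg : segment ℝ q0 (p.vertices v) ⊆ region p :=
          ((convex_segment x q0).segment_subset (right_mem_segment ℝ x q0) hv).trans hvis
        refine hxv v (((convex_segment x q0).segment_subset (left_mem_segment ℝ x q0) hv).trans
          hvis) ?_
        have hnear : ∀ᶠ a in 𝓝 q0, dist a q0 + dist x q0 < δ :=
          ContinuousAt.eventually_lt (by fun_prop) (by fun_prop) (by simpa using hd0)
        obtain ⟨a, haQ, ha1, ha2⟩ := ((mem_closure_iff_frequently.1 hq0).and_eventually
          (hnear.and (hT.eventually_common q0))).exists
        obtain ⟨t, ht, hat, hqt⟩ := ha2 (hQ haQ)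
        have h1 := hT.polyDist_le_add ht hat hqt hseg
        refine (add_le_add_left ((iInf₂_le a haQ).trans h1) _).trans_lt ?_
        rw [edist_dist, ← ENNReal.ofReal_add (by positivity) dist_nonneg,
          ENNReal.ofReal_lt_ofReal_iff_of_nonneg (by positivity)]
        have h2 := dist_add_dist_of_mem_segment hv
        rw [dist_comm _ q0] at h2
        linarith
      -- From an interior point one could move towards `x`, staying visible and getting closer.
      have hq0fr : q0 ∈ frontier Q := by
        by_contra hnf
        have hint : q0 ∈ interior Q := by
          rw [← closure_sdiff_frontier]; exact ⟨hq0, hnf⟩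
        have hcont : Tendsto (fun ε : ℝ => AffineMap.lineMap q0 x ε) (𝓝[>] 0) (𝓝 q0) := by
          have : Continuous (fun ε : ℝ => (AffineMap.lineMap q0 x ε : Plane)) :=
            AffineMap.lineMap_continuous
          simpa using (this.tendsto 0).mono_left (nhdsWithin_le_nhds (s := Set.Ioi 0))
        have hunit : ∀ᶠ ε : ℝ in 𝓝[>] 0, ε < 1 :=
          nhdsWithin_le_nhds (eventually_lt_nhds one_pos)
        obtain ⟨ε, h1, h2, h3⟩ := ((hcont.eventually (mem_interior_iff_mem_nhds.1 hint)).and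
          (hunit.and (self_mem_nhdsWithin (s := Set.Ioi (0 : ℝ))))).exists
        have h2 : ε < 1 := h2
        have h3 : 0 < ε := h3
        have hw : AffineMap.lineMap q0 x ε ∈ segment ℝ x q0 := by
          rw [segment_symm, segment_eq_image_lineMap]
          exact ⟨ε, ⟨h3.le, h2.le⟩, rfl⟩
        have h4 : dist x q0 ≤ dist x (AffineMap.lineMap q0 x ε) := hmin
          ⟨subset_closure h1, ((convex_segment x q0).segment_subset
            (left_mem_segment ℝ x q0) hw).trans hvis⟩
        have h5 := dist_add_dist_of_mem_segment hw
        have h6 : dist (AffineMap.lineMap q0 x ε) q0 = ε * dist q0 x := by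
          rw [dist_lineMap_left, Real.norm_eq_abs, abs_of_pos h3]
        have h7 : 0 < ε * dist q0 x := mul_pos h3 (dist_pos.2 hne.symm)
        linarith
      by_cases hq0E : q0 ∈ E
      · exact hxE q0 ⟨hq0E, hq0⟩ hvis hd0
      obtain ⟨f, hf, hf0, hfq⟩ := hfr q0 hq0fr
      have hxf : x ∉ X f := fun h => hxX ⟨f, hf, h⟩ hxU
      -- Near `q0` the whole curve belongs to the frontier and is visible from `x`, so the
      -- constrained minimum is an unconstrained local minimum on the curve.
      have hπx : π f x = q0 := by
        refine hπm f x hxf q0 hfq (hcrit f hf hf0 q0 hq0E hfq) ?_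
        have hvis' : segment ℝ q0 x ⊆ region p := by rwa [segment_symm]
        filter_upwards [hloc f hf hf0 q0 hq0E hfq hq0fr, hT.eventually_visible hvis' hnov]
          with y hy1 hy2 hfy
        have hyc : y ∈ closure Q := frontier_subset_closure (hy1 hfy)
        refine hmin ⟨hyc, ?_⟩
        show segment ℝ x y ⊆ region p
        rw [segment_symm]
        exact hy2 (hQP hyc)
      exact hxF f hf (by rw [hπx]; exact ⟨hq0, hvis⟩) (by rw [hπx]; exact hd0)
    · refine Set.union_subset (Set.union_subset (Set.union_subset (Set.union_subset ?_ ?_) ?_) ?_)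
        Set.inter_subset_right
      · intro x hx
        exact hT.mem_thickening_of_closure hQ hx (by simpa using hQP hx) (by simpa using hδ)
      · simp only [Set.iUnion_subset_iff]
        exact fun v x hx => mem_thickening_of_vertex hx.1 hx.2
      · simp only [Set.iUnion_subset_iff]
        exact fun e he x hx => hT.mem_thickening_of_closure hQ he.2 hx.1 hx.2
      · simp only [Set.iUnion_subset_iff]
        exact fun f _ x hx => hT.mem_thickening_of_closure hQ hx.1.1 hx.1.2 hx.2
  rw [hsplit]
  refine TameSet.union (TameSet.union (TameSet.union (TameSet.union hQt.closure ?_) ?_) ?_)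
    (TameSet.finite ((hF.biUnion fun f _ => hX f).subset Set.inter_subset_left))
  · exact TameSet.iUnion fun v =>
      ((TameFoot.const _).visible hPl).inter (tameSet_add_edist_lt _ _ _)
  · exact TameSet.biUnion (hE.subset Set.inter_subset_left) fun e _ =>
      ((TameFoot.const e).visible hPl).inter (TameSet.ball e δ)
  · exact TameSet.biUnion hF fun f _ =>
      (((hπ f).preimage hQt.closure).inter ((hπ f).visible hPl)).inter (hπd f δ)

/-! ### The regions of the procedure -/

namespace State

variable {E : GuardedPolygon n}

/-- All assigned regions are tame subsets of their triangles. -/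
def IsTame (s : State E) : Prop :=
  ∀ (g : E.Guard) (t : E.Tri), (TameSet (s.R₁ g t) ∧ s.R₁ g t ⊆ E.triSet t) ∧
    (TameSet (s.R₂ g t) ∧ s.R₂ g t ⊆ E.triSet t)

theorem tameSet_triSet (E : GuardedPolygon n) (t : E.Tri) : TameSet (E.triSet t) :=
  (E.triangulation.linTame_hull t.2).tameSet

theorem triSet_subset (E : GuardedPolygon n) (t : E.Tri) : E.triSet t ⊆ region E.poly :=
  E.triangulation.hull_subset t.2

theorem IsTame.firstRegion {s : State E} (h : s.IsTame) (g : E.Guard) (u : Fin n) (t : E.Tri) :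
    TameSet (s.firstRegion g u t) := by
  by_cases ha : s.Available g u t
  · have e : s.firstRegion g u t = E.triSet t \
        ⋃ k ∈ {k : E.Guard | k ≠ g ∧ E.Incident k t}, s.R₂ k t := by
      ext x
      simp only [State.firstRegion, ha, true_and, Set.mem_ofPred_eq, Set.mem_sdiff, Set.mem_iUnion,
        not_exists, and_imp]
    rw [e]
    exact (tameSet_triSet E t).diff (TameSet.biUnion (Set.toFinite _) fun k _ => (h k t).2.1)
  · convert TameSet.empty using 1
    ext x; simp [State.firstRegion, ha]

theorem firstRegion_subset (s : State E) (g : E.Guard) (u : Fin n) (t : E.Tri) :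
    s.firstRegion g u t ⊆ E.triSet t := fun _ hx => hx.2.1

theorem IsTame.free {s : State E} (h : s.IsTame) (t : E.Tri) : TameSet (s.free t) :=
  (tameSet_triSet E t).diff (TameSet.iUnion fun k => (h k t).1.1.union (h k t).2.1)

theorem IsTame.secondRegion {s : State E} (h : s.IsTame) (r : ℝ) (g : E.Guard) (u : Fin n)
    (t : E.Tri) : TameSet (s.secondRegion r g u t) := by
  unfold State.secondRegion
  split_ifs with h1 h2
  · have hQ : TameSet (s.firstUnion g u) := TameSet.iUnion fun t => h.firstRegion g u t
    have hQP : s.firstUnion g u ⊆ region E.poly :=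
      Set.iUnion_subset fun t => (s.firstRegion_subset g u t).trans (triSet_subset E t)
    -- The points outside all balls form the complement of a thickening, so the infinite
    -- intersection needs no separate treatment.
    have e : (⋂ q ∈ s.firstUnion g u, (polyBall E.poly (E.len g / r) q)ᶜ) =
        (thickening E.poly (E.len g / r) (s.firstUnion g u))ᶜ := by
      ext x
      simp only [polyBall, thickening, Set.mem_iInter, Set.mem_compl_iff, Set.mem_ofPred_eq, not_and,
        not_exists]
      exact ⟨fun H hx q hq => H q hq hx, fun H q hq hx => H hx q hq⟩
    rw [e]
    exact (E.triangulation.tameSet_thickening hQ hQP _).compl.inter (h.free t)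
  · exact h.free t
  · exact TameSet.empty

theorem secondRegion_subset (r : ℝ) (s : State E) (g : E.Guard) (u : Fin n) (t : E.Tri) :
    s.secondRegion r g u t ⊆ E.triSet t := by
  unfold State.secondRegion
  split_ifs
  · exact fun x hx => hx.2.1
  · exact fun x hx => hx.1
  · exact Set.empty_subset _

theorem IsTame.step {r : ℝ} {s s' : State E} (h : s.IsTame) (hs : Step r s s') : s'.IsTame := by
  cases hs with
  | alloc g u _ =>
    intro k t
    by_cases hk : k = g
    · subst hk
      simp only [State.allocate, Function.update_self]
      exact ⟨⟨h.firstRegion k u t, s.firstRegion_subset k u t⟩, h.secondRegion r k u t,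
        s.secondRegion_subset r k u t⟩
    · simp only [State.allocate, Function.update_of_ne hk]
      exact h k t
  | arbit g u _ _ _ => exact h

theorem Reachable.isTame {r : ℝ} {s : State E} (hs : s.Reachable r) : s.IsTame := by
  induction hs with
  | refl =>
    intro g t
    exact ⟨⟨TameSet.empty, Set.empty_subset _⟩, TameSet.empty, Set.empty_subset _⟩
  | tail _ hstep ih => exact ih.step hstep

end State

end GuardTracking

theorem mainTheorem7 {n : ℕ} (E : GuardTracking.GuardedPolygon n) (r : ℝ) (hr : 0 < r)
    (s : GuardTracking.State E) (hs : s.Reachable r)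
    (g : E.Guard) (hg : s.first g ≠ none) :
    GuardTracking.BoundedByArcs (s.U₁ g) ∧ GuardTracking.BoundedByArcs (s.U₂ g) := by
  have h := GuardTracking.State.Reachable.isTame hs
  have hb := E.triangulation.isCompact_region.isBounded
  refine ⟨(GuardTracking.TameSet.iUnion fun t => (h g t).1.1).boundedByArcs (hb.subset ?_),
    (GuardTracking.TameSet.iUnion fun t => (h g t).2.1).boundedByArcs (hb.subset ?_)⟩
  · exact Set.iUnion_subset fun t =>
      (h g t).1.2.trans (GuardTracking.State.triSet_subset E t)
  · exact Set.iUnion_subset fun t =>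
      (h g t).2.2.trans (GuardTracking.State.triSet_subset E t)
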